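/- **Setting.** Let $(\mathbf Y,\mathcal Y,\nu)$ be a measure space and let $A$ be an injective linear operator from (a linear subspace of) $L_2(\mathbf R^d)$ to $L_2(\mathbf Y)$. Let $Q=(A^{-1})^*$, that is, $Q$ is a linear operator from a subspace of $L_2(\mathbf R^d)$ to $L_2(\mathbf Y)$ with $$\int_{\mathbf R^d}(A^{-1}h)\,g=\int_{\mathbf Y}h\,(Qg)\,d\nu$$ for all $h$ in the range of $A$ and all $g$ in the domain of $Q$. Elements of these spaces are understood as functions, not as equivalence classes: $A$ and $Q$ act linearly on functions, map almost everywhere equal functions to almost everywhere equal functions, and inequalities between functions to which $Q$ is applied, or between values of $Q$, hold pointwise. Let $\mathcal F$ be a class of square integrable functions $f:\mathbf R^d\to\mathbf R$, contained in the domains of $A$ and $Q$, with $\sup_{f\in\mathcal F}\|f\|_2\le B_2$, where $0<B_2<\infty$. For every $\delta>0$ let $\mathcal F_\delta=\{(g^L_j,g^U_j):j=1,\dots,N_\delta\}$ be a finite $\delta$-bracketing net of $\mathcal F$: a set of $\#\mathcal F_\delta = N_\delta$ pairs of functions in the domain of $Q$ such that $\|g_j^L-g_j^U\|_2\le\delta$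 for all $j$, and for each $g\in\mathcal F$ there is $j$ with $g^L_j\le g\le g^U_j$. Put $\mathcal F^L_\delta=\{g^L_j\}$, $\mathcal F^U_\delta=\{g^U_j\}$ and $$\varrho_{\rm den}(Q,\mathcal F_\delta)=\max\Big\{\max_{g\in\mathcal F^L_\delta,\ h\in\mathcal F^U_\delta,\ g\ne h}\frac{\|Q(h-g)\|_2}{\|h-g\|_2},\ \max_{f\in\mathcal F^L_\delta,\ g\in\mathcal F^L_{2\delta},\ f\ne g}\frac{\|Q(f-g)\|_2}{\|f-g\|_2}\Big\},$$ where quotients $0/0$ are read as $0$, and $$G(\delta)=\int_0^\delta\varrho_{\rm den}(Q,\mathcal F_u)\sqrt{\log_e(\#\mathcal F_u)}\,du,\qquad \delta\in(0,B_2].$$ **Theorem.** Assume that 1. the integral defining $G(B_2)$ converges; 2. $G(\delta)/\delta^2$ is decreasing (in the weak sense) on $(0,B_2]$; 3. $\varrho_{\rm den}(Q,\mathcal F_\delta)=c\,\delta^{-a}$ for $\delta\in(0,B_2]$, where $0\le a<1$ and $c>0$; 4. $\lim_{\delta\to0}G(\delta)\delta^{a-1}=\infty$; 5. $\delta\mapsto\varrho_{\rm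 den}(Q,\mathcal F_\delta)\sqrt{\log_e(\#\mathcal F_\delta)}$ is decreasing (in the weak sense) on $(0,B_2]$; 6. $\sup_{f\in\mathcal F}\|Af\|_\infty<\infty$ and $\sup_{g\in\mathcal F^L_{B_2}\cup\mathcal F^U_{B_2}}\|Qg\|_\infty<\infty$; 7. $Q$ preserves positivity: $g\ge0$ implies $Qg\ge0$. Let $C>0$. Then there is a constant $C'>0$ such that the following holds. Let $\psi_n\in(0,B_2]$ satisfy, for all sufficiently large $n$, $$\psi_n^2\ge C\,n^{-1/2}\,G(\psi_n),$$ and let $\lim_{n\to\infty}n\psi_n^{2(1+a)}=\infty$. Then for all sufficiently large $n$, for every $\epsilon_n>0$ and every $f\in\mathcal F$ for which $Af$ is a probability density with respect to $\nu$, if $Y_1,\dots,Y_n$ are i.i.d. with density $Af$ and $\hat f=\hat f(Y_1,\dots,Y_n)\in\mathcal F$ is a dense minimizer, that is, $$\gamma_n(\hat f)\le\inf_{g\in\mathcal F}\gamma_n(g)+\epsilon_n,\qquad \gamma_n(g)=-\frac2n\sum_{i=1}^n(Qg)(Y_i)+\|g\|_2^2,$$ such that $\|\hat f-f\|_2$ is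 measurable, then $$E\|\hat f-f\|_2^2\le C'(\psi_n^2+\epsilon_n).$$ The constant $C'$ and the threshold for $n$ do not depend on $f$, $\epsilon_n$ and $\hat f$, and $C'$ does not depend on the sequence $(\psi_n)$. -/

import Mathlib

open MeasureTheory Filter Set Topology

noncomputable section

/-- A linear operator between spaces of square integrable functions, defined on a linear
subspace `domain` of the square integrable functions on `X` (the whole space is allowed; the
values of `toFun` outside `domain` are irrelevant). Its arguments and values are genuine functions,
since the values are evaluated at observations; almost everywhere equal arguments have almost
everywhere equal images, so the operator acts on `L²` classes as well. -/
structure L2Operator {X Y : Type*} [MeasurableSpace X] [MeasurableSpace Y]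
    (μ : Measure X) (ν : Measure Y) where
  /-- the domain of the operator -/
  domain : Submodule ℝ (X → ℝ)
  /-- the operator itself -/
  toFun : (X → ℝ) → (Y → ℝ)
  memLp_of_mem : ∀ f ∈ domain, MemLp f 2 μ
  memLp_apply : ∀ f ∈ domain, MemLp (toFun f) 2 ν
  map_add : ∀ f ∈ domain, ∀ g ∈ domain, toFun (f + g) = toFun f + toFun g
  map_smul : ∀ (r : ℝ), ∀ f ∈ domain, toFun (r • f) = r • toFun f
  congr_ae : ∀ f ∈ domain, ∀ g ∈ domain, f =ᵐ[μ] g → toFun f =ᵐ[ν] toFun g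

instance {X Y : Type*} [MeasurableSpace X] [MeasurableSpace Y]
    (μ : Measure X) (ν : Measure Y) :
    CoeFun (L2Operator μ ν) (fun _ => (X → ℝ) → (Y → ℝ)) := ⟨L2Operator.toFun⟩

section Operators

variable {X Y : Type*} [MeasurableSpace X] [MeasurableSpace Y] {μ : Measure X} {ν : Measure Y}

/-- `Q` is an adjoint of the inverse of `A`: the operator `A` is injective on `L²`, and
`∫ (A⁻¹ h) g dμ = ∫ h (Q g) dν` for all `h = A f` in the range of `A` and all `g` in the domain
of `Q`. -/
def IsAdjointOfInverse (A Q : L2Operator μ ν) : Prop :=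
  (∀ f ∈ A.domain, A f =ᵐ[ν] 0 → f =ᵐ[μ] 0) ∧
    ∀ f ∈ A.domain, ∀ g ∈ Q.domain, ∫ x, f x * g x ∂μ = ∫ y, A f y * Q g y ∂ν

/-- `g ≥ 0` implies `Q g ≥ 0`. -/
def PreservesPositivity (Q : L2Operator μ ν) : Prop :=
  ∀ g ∈ Q.domain, (∀ x, 0 ≤ g x) → ∀ y, 0 ≤ Q g y

/-- The finite set `N` of pairs `(g^L, g^U)` is a `δ`-bracketing net of `F` for the `L²` norm. -/
def IsBracketingNet (μ : Measure X) (F : Set (X → ℝ)) (δ : ℝ)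
    (N : Finset ((X → ℝ) × (X → ℝ))) : Prop :=
  (∀ p ∈ N, MemLp p.1 2 μ ∧ MemLp p.2 2 μ ∧ eLpNorm (p.1 - p.2) 2 μ ≤ ENNReal.ofReal δ) ∧
    ∀ g ∈ F, ∃ p ∈ N, ∀ x, p.1 x ≤ g x ∧ g x ≤ p.2 x

/-- The lower functions `g^L` of a set of brackets. -/
def lowerFns (N : Finset ((X → ℝ) × (X → ℝ))) : Set (X → ℝ) := {g | ∃ p ∈ N, p.1 = g}

/-- The upper functions `g^U` of a set of brackets. -/
def upperFns (N : Finset ((X → ℝ) × (X → ℝ))) : Set (X → ℝ) := {g | ∃ p ∈ N, p.2 = g}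

/-- The largest ratio `‖Q (f - g)‖₂ / ‖f - g‖₂` over `f ∈ S`, `g ∈ T`, `f ≠ g`
(used for finite `S` and `T`). -/
def opRatio (Q : L2Operator μ ν) (S T : Set (X → ℝ)) : ℝ :=
  sSup {r | ∃ f ∈ S, ∃ g ∈ T, f ≠ g ∧
    r = (eLpNorm (Q (f - g)) 2 ν).toReal / (eLpNorm (f - g) 2 μ).toReal}

/-- The operator norm `ϱ_den(Q, F_δ)` along a family of bracketing nets. -/
def rhoDen (Q : L2Operator μ ν) (net : ℝ → Finset ((X → ℝ) × (X → ℝ))) (δ : ℝ) : ℝ :=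
  max (opRatio Q (upperFns (net δ)) (lowerFns (net δ)))
    (opRatio Q (lowerFns (net δ)) (lowerFns (net (2 * δ))))

/-- The integrand `ϱ_den(Q, F_u) √(log #F_u)` of the entropy integral. -/
def entropyIntegrand (Q : L2Operator μ ν) (net : ℝ → Finset ((X → ℝ) × (X → ℝ))) (u : ℝ) : ℝ :=
  rhoDen Q net u * √(Real.log ((net u).card : ℝ))

/-- The entropy integral `G(δ)`. -/
def entropyIntegral (Q : L2Operator μ ν) (net : ℝ → Finset ((X → ℝ) × (X → ℝ))) (δ : ℝ) : ℝ :=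
  ∫ u in Ioc 0 δ, entropyIntegrand Q net u

/-- The empirical risk `γ_n(g) = -2 n⁻¹ ∑ (Q g)(Y_i) + ‖g‖₂²` at the sample `y`. -/
def empiricalRisk (Q : L2Operator μ ν) {n : ℕ} (y : Fin n → Y) (g : X → ℝ) : ℝ :=
  -2 * (n : ℝ)⁻¹ * ∑ i, Q g (y i) + ∫ x, g x ^ 2 ∂μ

/-- `fhat` (a function of the sample) minimizes the empirical risk over `F` up to `ε`. -/
def IsDenseMinimizer (Q : L2Operator μ ν) (F : Set (X → ℝ)) (ε : ℝ) {n : ℕ}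
    (fhat : (Fin n → Y) → (X → ℝ)) : Prop :=
  ∀ y, fhat y ∈ F ∧ ∀ g ∈ F, empiricalRisk Q y (fhat y) ≤ empiricalRisk Q y g + ε

/-- `h` is a probability density with respect to `ν`. -/
def IsProbDensity (ν : Measure Y) (h : Y → ℝ) : Prop :=
  AEMeasurable h ν ∧ 0 ≤ᵐ[ν] h ∧ ∫⁻ y, ENNReal.ofReal (h y) ∂ν = 1

/-- The law of `n` i.i.d. observations with density `h` with respect to `ν`. -/
def sampleLaw (ν : Measure Y) (h : Y → ℝ) (n : ℕ) : Measure (Fin n → Y) :=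
  Measure.pi fun _ => ν.withDensity fun y => ENNReal.ofReal (h y)

end Operators

end

/-!
By the adjoint relation, `Q g` is under the density `A f` an unbiased estimator of `∫ f g`, so that
an approximate minimizer `g` of the empirical risk satisfies
`‖g - f‖² ≤ 2 (ℙₙ - P)(Q g - Q f) + ε` (`sq_eLpNorm_sub_le`). Only an *upper* bound for the empirical
process is needed, and this makes one-sided chaining possible.

For a function `g` choose a bracket of size `δ / 2 ^ k` at each level `k`. As `Q` preserves
positivity, the images of the upper functions lie above `Q g`, and so do their running minima
`u₀ ≥ u₁ ≥ …`. Then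
`(ℙₙ - P)(Q g - Q f) ≤ (ℙₙ - P)(u₀ - Q f) + ∑ₖ (ℙₙ - P)(uₖ₊₁ - uₖ) + P(u_K - Q g)`.
The increments `uₖ₊₁ - uₖ` are nonpositive, and since `exp z ≤ 1 + z + z²` for all `z ≤ 1` the upper
tail of the empirical mean of a nonpositive variable is subgaussian, with a variance factor given by
its second moment and without any boundedness assumption (`integral_exp_sub_integral_le`). Hence no
truncation of the increments is required; boundedness enters only in the term `u₀ - Q f`. The second
moment of an increment is of order `(ϱ(δₖ) δₖ)²`, `δₖ = δ / 2 ^ k`, and the number of possible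
increments is at most the product of the cardinalities of the nets up to that level. As
`ϱ(δₖ) δₖ = c δₖ ^ (1 - a)` decreases geometrically, the resulting sum of thresholds is of order
`n ^ (-1/2) G(δ)` (`exists_chaining_bound`, `exists_chaining_bound_geometric`).

The entropy integral `G` is concave because its integrand is decreasing
(`setIntegral_le_div_mul`). So `n ^ (-1/2) G(δ)` is at most a small multiple of `δ²` as soon as
`δ ≥ L ψₙ` with `L` large, whatever the constant `C` is. On the shell `2 δ ≤ ‖g - f‖ ≤ 4 δ` the
empirical process exceeds `δ²` only by an amount of expectation `O(δ² / (n δ ^ (2 + 2 a))²)`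
(`exists_shell_bound`), and this is summable over the dyadic shells `δ = 2 ^ j L ψₙ` with a sum of
order `ψₙ²`, once `n ψₙ ^ (2 + 2 a) ≥ 1` (`lintegral_sq_le_of_shells`). All bounds hold for every
sample simultaneously, with a measurable excess term, so that no measurability of suprema is needed.
-/

/-! ### Deviations of empirical means -/

section EmpiricalDeviation

variable {Y : Type*} [MeasurableSpace Y]

/-- The deviation `n⁻¹ ∑ h(yᵢ) - ∫ h dP` of the empirical mean of `h` from its expectation. -/
noncomputable def empDev (P : Measure Y) {n : ℕ} (y : Fin n → Y) (h : Y → ℝ) : ℝ :=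
  (n : ℝ)⁻¹ * ∑ i, h (y i) - ∫ z, h z ∂P

lemma empDev_sub (P : Measure Y) {n : ℕ} (y : Fin n → Y) {g h : Y → ℝ}
    (hg : Integrable g P) (hh : Integrable h P) :
    empDev P y (g - h) = empDev P y g - empDev P y h := by
  simp only [empDev, Pi.sub_apply, integral_sub hg hh, Finset.sum_sub_distrib]
  ring

lemma aemeasurable_empDev (P : Measure Y) [IsProbabilityMeasure P] {n : ℕ} {h : Y → ℝ}
    (hh : AEMeasurable h P) :
    AEMeasurable (fun y : Fin n → Y => empDev P y h) (Measure.pi fun _ => P) := by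
  unfold empDev
  refine (AEMeasurable.const_mul ?_ _).sub aemeasurable_const
  exact Finset.aemeasurable_fun_sum _ fun i _ =>
    hh.comp_quasiMeasurePreserving (Measure.quasiMeasurePreserving_eval (fun _ : Fin n => P) i)

lemma exp_le_one_add_add_sq {z : ℝ} (hz : z ≤ 1) : Real.exp z ≤ 1 + z + z ^ 2 := by
  rcases le_or_gt (-1) z with h | h
  · have := (abs_le.1 (Real.abs_exp_sub_one_sub_id_le (abs_le.2 ⟨h, hz⟩))).2
    linarith
  · have : Real.exp z ≤ 1 := Real.exp_le_one_iff.2 (by linarith)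
    nlinarith

lemma integrable_exp_of_le_one {P : Measure Y} [IsProbabilityMeasure P] {h : Y → ℝ}
    (hh : AEMeasurable h P) (h1 : ∀ᵐ y ∂P, h y ≤ 1) :
    Integrable (fun y => Real.exp (h y)) P := by
  refine Integrable.of_bound (C := Real.exp 1)
    (Real.measurable_exp.comp_aemeasurable hh).aestronglyMeasurable ?_
  filter_upwards [h1] with y hy
  rw [Real.norm_eq_abs, Real.abs_exp]
  exact Real.exp_le_exp.2 hy

/-- A one-sided Bernstein bound: only an upper bound on `θ h` is needed, so that for `h ≤ 0` every
`θ ≥ 0` is allowed. -/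
lemma integral_exp_sub_integral_le {P : Measure Y} [IsProbabilityMeasure P] {h : Y → ℝ}
    (hh : MemLp h 2 P) {θ v : ℝ} (h1 : ∀ᵐ y ∂P, θ * h y ≤ 1)
    (hv : ∫ y, h y ^ 2 ∂P ≤ v) :
    ∫ y, Real.exp (θ * (h y - ∫ z, h z ∂P)) ∂P ≤ Real.exp (θ ^ 2 * v) := by
  set m := ∫ z, h z ∂P
  have hi : Integrable h P := hh.integrable one_le_two
  have hi2 := hh.integrable_sq
  have hA : ∫ y, Real.exp (θ * h y) ∂P ≤ 1 + θ * m + θ ^ 2 * ∫ y, h y ^ 2 ∂P := by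
    calc ∫ y, Real.exp (θ * h y) ∂P
        ≤ ∫ y, (1 + θ * h y + θ ^ 2 * h y ^ 2) ∂P := by
          refine integral_mono_ae (integrable_exp_of_le_one (hi.aemeasurable.const_mul θ) h1)
            (((integrable_const _).add (hi.const_mul _)).add (hi2.const_mul _)) ?_
          filter_upwards [h1] with y hy
          have := exp_le_one_add_add_sq hy
          rw [mul_pow] at this
          exact this
      _ = _ := by
          have e1 : Integrable (fun y => 1 + θ * h y) P :=
            (integrable_const _).add (hi.const_mul _)
          rw [integral_add e1 (hi2.const_mul _), integral_add (integrable_const _) (hi.const_mul _),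
            integral_const_mul, integral_const_mul]
          simp [m]
  calc ∫ y, Real.exp (θ * (h y - m)) ∂P
      = Real.exp (-(θ * m)) * ∫ y, Real.exp (θ * h y) ∂P := by
        rw [← integral_const_mul]
        congr 1 with y
        rw [← Real.exp_add]
        congr 1
        ring
    _ ≤ Real.exp (-(θ * m)) * Real.exp (θ * m + θ ^ 2 * v) := by
        gcongr
        have := Real.add_one_le_exp (θ * m + θ ^ 2 * v)
        nlinarith [mul_le_mul_of_nonneg_left hv (sq_nonneg θ)]
    _ = Real.exp (θ ^ 2 * v) := by rw [← Real.exp_add]; congr 1; ring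

/-- Chernoff bound for the expected excess of an empirical deviation over the level `t`. -/
lemma lintegral_empDev_sub_posPart_le {P : Measure Y} [IsProbabilityMeasure P] {n : ℕ}
    (hn : n ≠ 0) {h : Y → ℝ} (hh : MemLp h 2 P) {l v : ℝ} (t : ℝ) (hl : 0 < l)
    (h1 : ∀ᵐ y ∂P, l / n * h y ≤ 1) (hv : ∫ y, h y ^ 2 ∂P ≤ v) :
    ∫⁻ y, ENNReal.ofReal (max (empDev P y h - t) 0) ∂(Measure.pi fun _ : Fin n => P)
      ≤ ENNReal.ofReal (l⁻¹ * Real.exp (-(l * t) + l ^ 2 * v / n)) := by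
  have hn' : (n : ℝ) ≠ 0 := by exact_mod_cast hn
  set m := ∫ z, h z ∂P with hm
  set e : Y → ℝ := fun z => Real.exp (l / n * (h z - m)) with he
  have heint : Integrable e P := by
    have := (integrable_exp_of_le_one ((hh.integrable one_le_two).aemeasurable.const_mul _)
      h1).const_mul (Real.exp (-(l / n * m)))
    refine this.congr (ae_of_all _ fun z => ?_)
    simp only [he]
    rw [← Real.exp_add]
    congr 1
    ring
  have hprod : ∀ y : Fin n → Y, Real.exp (l * empDev P y h) = ∏ i, e (y i) := by
    intro y
    simp only [he]
    rw [← Real.exp_sum, ← Finset.mul_sum, Finset.sum_sub_distrib]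
    simp only [Finset.sum_const, Finset.card_univ, Fintype.card_fin, nsmul_eq_mul, empDev]
    congr 1
    rw [← hm]
    field_simp
  have hpt : ∀ y : Fin n → Y, max (empDev P y h - t) 0
      ≤ l⁻¹ * Real.exp (-(l * t)) * ∏ i, e (y i) := by
    intro y
    rw [← hprod, mul_assoc, ← Real.exp_add]
    refine max_le ?_ (by positivity)
    have := Real.add_one_le_exp (-(l * t) + l * empDev P y h)
    rw [inv_mul_eq_div, le_div_iff₀ hl]
    nlinarith
  have hI : Integrable (fun y : Fin n → Y => l⁻¹ * Real.exp (-(l * t)) * ∏ i, e (y i))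
      (Measure.pi fun _ : Fin n => P) :=
    (Integrable.fintype_prod (fun _ => heint)).const_mul _
  calc _ ≤ ∫⁻ y, ENNReal.ofReal (l⁻¹ * Real.exp (-(l * t)) * ∏ i, e (y i))
          ∂(Measure.pi fun _ : Fin n => P) :=
        lintegral_mono fun y => ENNReal.ofReal_le_ofReal (hpt y)
    _ = ENNReal.ofReal (l⁻¹ * Real.exp (-(l * t)) * (∫ z, e z ∂P) ^ n) := by
        rw [← ofReal_integral_eq_lintegral_ofReal hI (ae_of_all _ fun y => by positivity),
          integral_const_mul, integral_fintype_prod_eq_pow, Fintype.card_fin]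
    _ ≤ _ := by
        apply ENNReal.ofReal_le_ofReal
        rw [Real.exp_add, ← mul_assoc]
        gcongr
        calc (∫ z, e z ∂P) ^ n ≤ (Real.exp ((l / n) ^ 2 * v)) ^ n := by
              gcongr
              exact integral_exp_sub_integral_le hh h1 hv
          _ = _ := by
              rw [← Real.exp_nat_mul]
              congr 1
              field_simp

/-- The excesses over `t` of finitely many empirical deviations are small in expectation if `t`
dominates the logarithm `L` of their number and the extra amount `x`. -/
lemma exists_excess_of_finset {P : Measure Y} [IsProbabilityMeasure P] {n : ℕ}
    (hn : n ≠ 0) (X : Finset (Y → ℝ)) {v t H L x : ℝ} (hv : 0 < v) (ht : 0 < t)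
    (hX : ∀ h ∈ X, MemLp h 2 P) (hXv : ∀ h ∈ X, ∫ y, h y ^ 2 ∂P ≤ v)
    (hXH : ∀ h ∈ X, ∀ᵐ y ∂P, h y ≤ H) (htH : t * H ≤ 2 * v)
    (hcard : (X.card : ℝ) ≤ Real.exp L) (hLx : L + x ≤ n * t ^ 2 / (4 * v)) :
    ∃ W : (Fin n → Y) → ℝ, AEMeasurable W (Measure.pi fun _ => P) ∧ (∀ y, 0 ≤ W y) ∧
      ∫⁻ y, ENNReal.ofReal (W y) ∂(Measure.pi fun _ => P)
        ≤ ENNReal.ofReal (Real.exp (-x) * (2 * v / (n * t))) ∧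
      ∀ h ∈ X, ∀ y, empDev P y h ≤ t + W y := by
  have hn' : (0 : ℝ) < n := by exact_mod_cast Nat.pos_of_ne_zero hn
  have hmeas : ∀ h ∈ X, AEMeasurable (fun y : Fin n → Y => max (empDev P y h - t) 0)
      (Measure.pi fun _ => P) := fun h hh =>
    ((aemeasurable_empDev P (hX h hh).aestronglyMeasurable.aemeasurable).sub
      aemeasurable_const).max aemeasurable_const
  refine ⟨fun y => ∑ h ∈ X, max (empDev P y h - t) 0, Finset.aemeasurable_fun_sum _ hmeas,
    fun y => Finset.sum_nonneg fun h _ => le_max_right _ _, ?_, fun h hh y => ?_⟩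
  · have hl : 0 < n * t / (2 * v) := by positivity
    calc _ = ∫⁻ y, ∑ h ∈ X, ENNReal.ofReal (max (empDev P y h - t) 0)
          ∂(Measure.pi fun _ : Fin n => P) := by
          congr 1 with y
          exact ENNReal.ofReal_sum_of_nonneg fun h _ => le_max_right _ _
      _ = ∑ h ∈ X, ∫⁻ y, ENNReal.ofReal (max (empDev P y h - t) 0)
          ∂(Measure.pi fun _ : Fin n => P) :=
          lintegral_finsetSum' _ fun h hh => (hmeas h hh).ennreal_ofReal
      _ ≤ ∑ h ∈ X, ENNReal.ofReal ((n * t / (2 * v))⁻¹ * Real.exp (-(n * t ^ 2 / (4 * v)))) := by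
          refine Finset.sum_le_sum fun h hh => ?_
          refine (lintegral_empDev_sub_posPart_le hn (hX h hh) t hl ?_ (hXv h hh)).trans_eq ?_
          · filter_upwards [hXH h hh] with y hy
            have : n * t / (2 * v) / n = t / (2 * v) := by field_simp
            rw [this, div_mul_eq_mul_div, div_le_one (by positivity)]
            exact (mul_le_mul_of_nonneg_left hy ht.le).trans htH
          · congr 3
            field_simp
            ring
      _ = ENNReal.ofReal (X.card * ((n * t / (2 * v))⁻¹ * Real.exp (-(n * t ^ 2 / (4 * v))))) := by
          rw [Finset.sum_const, nsmul_eq_mul, ENNReal.ofReal_mul (Nat.cast_nonneg X.card),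
            ENNReal.ofReal_natCast]
      _ ≤ _ := by
          apply ENNReal.ofReal_le_ofReal
          calc X.card * ((n * t / (2 * v))⁻¹ * Real.exp (-(n * t ^ 2 / (4 * v))))
              ≤ Real.exp L * ((n * t / (2 * v))⁻¹ * Real.exp (-(L + x))) := by gcongr
            _ = Real.exp (-x) * (2 * v / (n * t)) := by
              rw [inv_div, neg_add, Real.exp_add, Real.exp_neg L]
              field_simp
  · have h1 := Finset.single_le_sum (f := fun h => max (empDev P y h - t) 0)
      (fun h _ => le_max_right _ _) hh
    have h2 := le_max_left (empDev P y h - t) 0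
    linarith

end EmpiricalDeviation

/-! ### One-sided bracketing chaining -/

section Chaining

variable {Y : Type*}

/-- The running minimum `min (q 0) … (q k)` of a sequence of functions. -/
noncomputable def runMin (q : ℕ → Y → ℝ) : ℕ → Y → ℝ
  | 0 => q 0
  | k + 1 => runMin q k ⊓ q (k + 1)

lemma runMin_le (q : ℕ → Y → ℝ) (k : ℕ) (y : Y) : runMin q k y ≤ q k y := by
  cases k with
  | zero => exact le_rfl
  | succ k => exact inf_le_right

lemma runMin_succ_le (q : ℕ → Y → ℝ) (k : ℕ) (y : Y) : runMin q (k + 1) y ≤ runMin q k y :=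
  inf_le_left

lemma le_runMin {q : ℕ → Y → ℝ} {w : Y → ℝ} (h : ∀ k y, w y ≤ q k y) (k : ℕ) (y : Y) :
    w y ≤ runMin q k y := by
  induction k with
  | zero => exact h 0 y
  | succ k ih => exact le_inf ih (h (k + 1) y)

lemma memLp_runMin [MeasurableSpace Y] {P : Measure Y} {q : ℕ → Y → ℝ} (hq : ∀ k, MemLp (q k) 2 P) (k : ℕ) :
    MemLp (runMin q k) 2 P := by
  induction k with
  | zero => exact hq 0
  | succ k ih => exact ih.inf (hq (k + 1))

/-- If the bracket at level `i` is taken from the finite set `S i`, the running minimum up to level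
`k` is one of at most `∏ i ≤ k, #(S i)` functions. -/
lemma exists_finset_runMin {ι α : Type*} (q : ℕ → α → Y → ℝ) (p : ℕ → ι → α) (S : ℕ → Finset α)
    (hp : ∀ k g, p k g ∈ S k) (k : ℕ) :
    ∃ T : Finset (Y → ℝ), T.card ≤ ∏ i ∈ Finset.range (k + 1), (S i).card ∧
      ∀ g, runMin (fun i => q i (p i g)) k ∈ T := by
  classical
  induction k with
  | zero =>
    refine ⟨(S 0).image (q 0), ?_, fun g => Finset.mem_image_of_mem _ (hp 0 g)⟩
    simpa using Finset.card_image_le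
  | succ k ih =>
    obtain ⟨T, hT, hmem⟩ := ih
    refine ⟨(T ×ˢ S (k + 1)).image fun z => z.1 ⊓ q (k + 1) z.2, ?_, fun g => ?_⟩
    · rw [Finset.prod_range_succ]
      refine Finset.card_image_le.trans ?_
      rw [Finset.card_product]
      gcongr
    · exact Finset.mem_image.2 ⟨(_, p (k + 1) g), Finset.mk_mem_product (hmem g) (hp _ g), rfl⟩

/-- The increments of the running minima at level `k + 1` range over at most `∏ i ≤ k + 1, #(S i)`
functions. The finite set is cut down to increments that actually occur, since only for these the
second moment is under control. -/
lemma exists_finset_runMin_succ_sub {ι α : Type*} (q : ℕ → α → Y → ℝ) (p : ℕ → ι → α)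
    (S : ℕ → Finset α) (hp : ∀ k g, p k g ∈ S k) (k : ℕ) :
    ∃ T : Finset (Y → ℝ), T.card ≤ ∏ i ∈ Finset.range (k + 2), (S i).card ∧
      (∀ g, runMin (fun i => q i (p i g)) (k + 1) - runMin (fun i => q i (p i g)) k ∈ T) ∧
      ∀ h ∈ T, ∃ g, h = runMin (fun i => q i (p i g)) (k + 1) - runMin (fun i => q i (p i g)) k := by
  classical
  obtain ⟨T, hT, hmem⟩ := exists_finset_runMin q p S hp k
  refine ⟨((T ×ˢ S (k + 1)).image fun z => z.1 ⊓ q (k + 1) z.2 - z.1).filter fun h =>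
    ∃ g, h = runMin (fun i => q i (p i g)) (k + 1) - runMin (fun i => q i (p i g)) k,
    ?_, fun g => ?_, fun h hh => (Finset.mem_filter.1 hh).2⟩
  · rw [Finset.prod_range_succ]
    refine (Finset.card_filter_le _ _).trans (Finset.card_image_le.trans ?_)
    rw [Finset.card_product]
    gcongr
  · exact Finset.mem_filter.2 ⟨Finset.mem_image.2
      ⟨(_, p (k + 1) g), Finset.mk_mem_product (hmem g) (hp _ g), rfl⟩, g, rfl⟩

lemma cast_le_exp_sum_log {T : ℕ} {N : ℕ → ℕ} {k : ℕ} (hT : T ≤ ∏ i ∈ Finset.range k, N i) :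
    (T : ℝ) ≤ Real.exp (∑ i ∈ Finset.range k, Real.log (N i)) := by
  rw [Real.exp_sum]
  calc (T : ℝ) ≤ ∏ i ∈ Finset.range k, (N i : ℝ) := by exact_mod_cast hT
    _ ≤ _ := Finset.prod_le_prod (fun i _ => by positivity) fun i _ => Real.le_exp_log _

variable [MeasurableSpace Y]

lemma integral_le_of_integral_sq_le {P : Measure Y} [IsProbabilityMeasure P] {h : Y → ℝ}
    (hh : MemLp h 2 P) {s : ℝ} (hs : 0 ≤ s) (hsq : ∫ y, h y ^ 2 ∂P ≤ s ^ 2) :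
    ∫ y, h y ∂P ≤ s := by
  have hi := hh.integrable one_le_two
  have hi2 := hh.integrable_sq
  set m := ∫ y, h y ∂P with hm
  have h0 : 0 ≤ ∫ y, (h y - m) ^ 2 ∂P := integral_nonneg fun y => sq_nonneg _
  have h1 : ∫ y, (h y - m) ^ 2 ∂P = ∫ y, h y ^ 2 ∂P - m ^ 2 := by
    have : ∀ y, (h y - m) ^ 2 = h y ^ 2 - 2 * m * h y + m ^ 2 := fun y => by ring
    simp_rw [this]
    have e1 : Integrable (fun y => h y ^ 2 - 2 * m * h y) P := hi2.sub (hi.const_mul _)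
    rw [integral_add e1 (integrable_const _), integral_sub hi2 (hi.const_mul _),
      integral_const_mul, ← hm]
    simp
    ring
  exact le_of_sq_le_sq (by linarith) hs

/-- **Chaining along upper brackets.** If `w g ≤ q k (p k g)` for all `k`, then `w g` is bounded by
the running minima of the upper brackets, whose increments have a fixed sign. Only the lower tails
of their empirical means are needed, and these are subgaussian without any truncation. -/
theorem exists_chaining_bound {ι α : Type*} {P : Measure Y} [IsProbabilityMeasure P] {n : ℕ}
    (hn : n ≠ 0) (q : ℕ → α → Y → ℝ) (p : ℕ → ι → α) (S : ℕ → Finset α)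
    (hp : ∀ k g, p k g ∈ S k) (w : ι → Y → ℝ) (w₀ : Y → ℝ)
    (hq : ∀ k g, MemLp (q k (p k g)) 2 P) (hw : ∀ g, MemLp (w g) 2 P) (hw₀ : MemLp w₀ 2 P)
    (hle : ∀ k g y, w g y ≤ q k (p k g) y)
    {s t : ℕ → ℝ} {v H x : ℝ} (hs : ∀ k, 0 < s k) (ht : ∀ k, 0 < t k) (hv : 0 < v)
    (hqs : ∀ k g, ∫ y, (q k (p k g) y - w g y) ^ 2 ∂P ≤ s k ^ 2)
    (hqv : ∀ g, ∫ y, (q 0 (p 0 g) y - w₀ y) ^ 2 ∂P ≤ v)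
    (hqH : ∀ g, ∀ᵐ y ∂P, q 0 (p 0 g) y - w₀ y ≤ H) (htH : t 0 * H ≤ 2 * v)
    (hL₀ : Real.log (S 0).card + x ≤ n * t 0 ^ 2 / (4 * v))
    (hL : ∀ k, ∑ i ∈ Finset.range (k + 2), Real.log (S i).card + x
      ≤ n * t (k + 1) ^ 2 / (4 * s k ^ 2)) (K : ℕ) :
    ∃ W : (Fin n → Y) → ℝ, AEMeasurable W (Measure.pi fun _ => P) ∧ (∀ y, 0 ≤ W y) ∧
      ∫⁻ y, ENNReal.ofReal (W y) ∂(Measure.pi fun _ => P)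
        ≤ ENNReal.ofReal (Real.exp (-x) * (2 * v / (n * t 0) +
            ∑ k ∈ Finset.range K, 2 * s k ^ 2 / (n * t (k + 1)))) ∧
      ∀ y g, empDev P y (w g) - empDev P y w₀
        ≤ t 0 + ∑ k ∈ Finset.range K, t (k + 1) + s K + W y := by
  classical
  set u : ℕ → ι → Y → ℝ := fun k g => runMin (fun i => q i (p i g)) k with hu
  have hu2 : ∀ k g, MemLp (u k g) 2 P := fun k g => memLp_runMin (fun i => hq i g) k
  have huint : ∀ k g, Integrable (u k g) P := fun k g => (hu2 k g).integrable one_le_two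
  have huw : ∀ k g y, w g y ≤ u k g y := fun k g y => le_runMin (fun i => hle i g) k y
  have huq : ∀ k g y, u k g y ≤ q k (p k g) y := fun k g y => runMin_le _ k y
  have husucc : ∀ k g y, u (k + 1) g y ≤ u k g y := fun k g y => runMin_succ_le _ k y
  have hqw2 : ∀ k g, Integrable (fun y => (q k (p k g) y - w g y) ^ 2) P := fun k g =>
    ((hq k g).sub (hw g)).integrable_sq
  have huws : ∀ k g, ∫ y, (u k g y - w g y) ^ 2 ∂P ≤ s k ^ 2 := fun k g =>
    (integral_mono ((hu2 k g).sub (hw g)).integrable_sq (hqw2 k g) fun y =>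
      pow_le_pow_left₀ (sub_nonneg.2 (huw k g y)) (sub_le_sub_right (huq k g y) _) 2).trans
      (hqs k g)
  have hdiff : ∀ k g, ∫ y, (u (k + 1) g - u k g) y ^ 2 ∂P ≤ s k ^ 2 := fun k g => by
    refine (integral_mono ((hu2 (k + 1) g).sub (hu2 k g)).integrable_sq
      ((hu2 k g).sub (hw g)).integrable_sq fun y => ?_).trans (huws k g)
    have h1 := huw (k + 1) g y
    have h2 := husucc k g y
    simp only [Pi.sub_apply]
    nlinarith
  -- the starting level
  obtain ⟨W₀, hW₀m, hW₀0, hW₀i, hW₀⟩ := exists_excess_of_finset (P := P) hn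
    (((S 0).image fun b => q 0 b - w₀).filter fun h => ∃ g, h = q 0 (p 0 g) - w₀)
    (v := v) (t := t 0) (H := H) (L := Real.log (S 0).card) (x := x) hv (ht 0)
    (fun h hh => by
      obtain ⟨g, rfl⟩ := (Finset.mem_filter.1 hh).2
      exact (hq 0 g).sub hw₀)
    (fun h hh => by
      obtain ⟨g, rfl⟩ := (Finset.mem_filter.1 hh).2
      exact hqv g)
    (fun h hh => by
      obtain ⟨g, rfl⟩ := (Finset.mem_filter.1 hh).2
      exact hqH g) htH
    (by
      refine le_trans ?_ (Real.le_exp_log _)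
      exact_mod_cast (Finset.card_filter_le _ _).trans Finset.card_image_le) hL₀
  -- the increments
  have hstep : ∀ k, ∃ W : (Fin n → Y) → ℝ, AEMeasurable W (Measure.pi fun _ => P) ∧
      (∀ y, 0 ≤ W y) ∧ ∫⁻ y, ENNReal.ofReal (W y) ∂(Measure.pi fun _ => P)
        ≤ ENNReal.ofReal (Real.exp (-x) * (2 * s k ^ 2 / (n * t (k + 1)))) ∧
      ∀ g y, empDev P y (u (k + 1) g - u k g) ≤ t (k + 1) + W y := by
    intro k
    obtain ⟨T, hT, hTmem, hTex⟩ := exists_finset_runMin_succ_sub q p S hp k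
    obtain ⟨W, h1, h2, h3, h4⟩ := exists_excess_of_finset (P := P) hn T (v := s k ^ 2)
      (t := t (k + 1)) (H := 0) (x := x) (pow_pos (hs k) 2) (ht (k + 1))
      (fun h hh => by
        obtain ⟨g, rfl⟩ := hTex h hh
        exact (hu2 (k + 1) g).sub (hu2 k g))
      (fun h hh => by
        obtain ⟨g, rfl⟩ := hTex h hh
        exact hdiff k g)
      (fun h hh => by
        obtain ⟨g, rfl⟩ := hTex h hh
        exact ae_of_all _ fun y => sub_nonpos.2 (husucc k g y))
      (by simpa using sq_nonneg (s k)) (cast_le_exp_sum_log hT) (hL k)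
    exact ⟨W, h1, h2, h3, fun g y => h4 _ (hTmem g) y⟩
  choose V hVm hV0 hVi hV using hstep
  refine ⟨fun y => W₀ y + ∑ k ∈ Finset.range K, V k y,
    hW₀m.add (Finset.aemeasurable_fun_sum _ fun k _ => hVm k),
    fun y => add_nonneg (hW₀0 y) (Finset.sum_nonneg fun k _ => hV0 k y), ?_, fun y g => ?_⟩
  · have hn' : (0 : ℝ) < n := by exact_mod_cast Nat.pos_of_ne_zero hn
    calc _ = ∫⁻ y, (ENNReal.ofReal (W₀ y) + ∑ k ∈ Finset.range K, ENNReal.ofReal (V k y))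
          ∂(Measure.pi fun _ : Fin n => P) := by
          congr 1 with y
          rw [ENNReal.ofReal_add (hW₀0 y) (Finset.sum_nonneg fun k _ => hV0 k y),
            ENNReal.ofReal_sum_of_nonneg fun k _ => hV0 k y]
      _ = ∫⁻ y, ENNReal.ofReal (W₀ y) ∂(Measure.pi fun _ : Fin n => P) +
          ∑ k ∈ Finset.range K, ∫⁻ y, ENNReal.ofReal (V k y)
            ∂(Measure.pi fun _ : Fin n => P) := by
          rw [lintegral_add_left' hW₀m.ennreal_ofReal,
            lintegral_finsetSum' _ fun k _ => (hVm k).ennreal_ofReal]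
      _ ≤ ENNReal.ofReal (Real.exp (-x) * (2 * v / (n * t 0))) + ∑ k ∈ Finset.range K,
          ENNReal.ofReal (Real.exp (-x) * (2 * s k ^ 2 / (n * t (k + 1)))) := by
          gcongr with k _
          exact hVi k
      _ = _ := by
          have hpos : ∀ k, 0 ≤ Real.exp (-x) * (2 * s k ^ 2 / (n * t (k + 1))) := fun k => by
            have := ht (k + 1)
            positivity
          have := ht 0
          rw [← ENNReal.ofReal_sum_of_nonneg fun k _ => hpos k,
            ← ENNReal.ofReal_add (by positivity) (Finset.sum_nonneg fun k _ => hpos k),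
            ← Finset.mul_sum, ← mul_add]
  · have htel : empDev P y (u K g) = empDev P y (u 0 g)
        + ∑ k ∈ Finset.range K, empDev P y (u (k + 1) g - u k g) := by
      have := Finset.sum_range_sub (fun k => empDev P y (u k g)) K
      simp_rw [empDev_sub P y (huint _ g) (huint _ g)]
      linarith
    have h0 : empDev P y (u 0 g) - empDev P y w₀ ≤ t 0 + W₀ y := by
      have hint : Integrable (q 0 (p 0 g)) P := (hq 0 g).integrable one_le_two
      have := hW₀ (q 0 (p 0 g) - w₀) (Finset.mem_filter.2
        ⟨Finset.mem_image_of_mem (fun b => q 0 b - w₀) (hp 0 g), g, rfl⟩) y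
      rwa [empDev_sub P y hint (hw₀.integrable one_le_two)] at this
    have hsum : ∑ k ∈ Finset.range K, empDev P y (u (k + 1) g - u k g)
        ≤ ∑ k ∈ Finset.range K, t (k + 1) + ∑ k ∈ Finset.range K, V k y := by
      rw [← Finset.sum_add_distrib]
      exact Finset.sum_le_sum fun k _ => hV k g y
    have hlast : empDev P y (w g) ≤ empDev P y (u K g) + s K := by
      have h1 : ∫ z, (u K g z - w g z) ∂P ≤ s K :=
        integral_le_of_integral_sq_le ((hu2 K g).sub (hw g)) (hs K).le (huws K g)
      rw [integral_sub (huint K g) ((hw g).integrable one_le_two)] at h1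
      have h2 : (n : ℝ)⁻¹ * ∑ i, w g (y i) ≤ (n : ℝ)⁻¹ * ∑ i, u K g (y i) := by
        gcongr
        exact huw K g _
      simp only [empDev]
      linarith
    linarith

end Chaining

/-! ### Integrals of decreasing functions -/

section Antitone

variable {φ : ℝ → ℝ} {B : ℝ}

lemma setIntegral_Ioc_sub (hφ : IntegrableOn φ (Ioc 0 B)) {a b : ℝ} (ha : 0 ≤ a) (hab : a ≤ b)
    (hb : b ≤ B) : ∫ u in Ioc 0 b, φ u = (∫ u in Ioc 0 a, φ u) + ∫ u in Ioc a b, φ u := by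
  rw [← Ioc_union_Ioc_eq_Ioc ha hab]
  refine setIntegral_union ?_ measurableSet_Ioc (hφ.mono_set ?_) (hφ.mono_set ?_)
  · exact Set.disjoint_left.2 fun x hx hx' => absurd hx.2 (not_le.2 hx'.1)
  · exact Ioc_subset_Ioc le_rfl (hab.trans hb)
  · exact Ioc_subset_Ioc ha hb

lemma sub_mul_le_setIntegral (hφ : IntegrableOn φ (Ioc 0 B)) (hmono : AntitoneOn φ (Ioc 0 B))
    {a b : ℝ} (ha : 0 ≤ a) (hab : a ≤ b) (hb : b ≤ B) :
    (b - a) * φ b ≤ ∫ u in Ioc a b, φ u := by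
  have hsub : Ioc a b ⊆ Ioc 0 B := Ioc_subset_Ioc ha hb
  calc (b - a) * φ b = ∫ _u in Ioc a b, φ b := by
        rw [setIntegral_const, Real.volume_real_Ioc_of_le hab, smul_eq_mul]
    _ ≤ _ := by
        refine setIntegral_mono_on (integrableOn_const (by simp)) (hφ.mono_set hsub)
          measurableSet_Ioc fun u hu => ?_
        exact hmono (hsub hu) ⟨(ha.trans_lt hu.1).trans_le hu.2, hb⟩ hu.2

lemma setIntegral_le_sub_mul (hφ : IntegrableOn φ (Ioc 0 B)) (hmono : AntitoneOn φ (Ioc 0 B))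
    {a b : ℝ} (ha : 0 < a) (hab : a ≤ b) (hb : b ≤ B) :
    ∫ u in Ioc a b, φ u ≤ (b - a) * φ a := by
  have hsub : Ioc a b ⊆ Ioc 0 B := Ioc_subset_Ioc ha.le hb
  calc _ ≤ ∫ _u in Ioc a b, φ a := by
        refine setIntegral_mono_on (hφ.mono_set hsub) (integrableOn_const (by simp))
          measurableSet_Ioc fun u hu => ?_
        exact hmono ⟨ha, hab.trans hb⟩ (hsub hu) hu.1.le
    _ = _ := by rw [setIntegral_const, Real.volume_real_Ioc_of_le hab, smul_eq_mul]

lemma mul_le_setIntegral (hφ : IntegrableOn φ (Ioc 0 B)) (hmono : AntitoneOn φ (Ioc 0 B))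
    {δ : ℝ} (hδ : δ ∈ Ioc 0 B) : δ * φ δ ≤ ∫ u in Ioc 0 δ, φ u := by
  simpa using sub_mul_le_setIntegral hφ hmono le_rfl hδ.1.le hδ.2

/-- The primitive of a decreasing function is concave and vanishes at `0`, so it grows at most
linearly. -/
lemma setIntegral_le_div_mul (hφ : IntegrableOn φ (Ioc 0 B)) (hmono : AntitoneOn φ (Ioc 0 B))
    {a b : ℝ} (ha : 0 < a) (hab : a ≤ b) (hb : b ≤ B) :
    ∫ u in Ioc 0 b, φ u ≤ b / a * ∫ u in Ioc 0 a, φ u := by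
  rw [setIntegral_Ioc_sub hφ ha.le hab hb]
  have h1 := setIntegral_le_sub_mul hφ hmono ha hab hb
  have h2 := mul_le_setIntegral hφ hmono ⟨ha, hab.trans hb⟩
  have h3 : (b - a) * φ a ≤ (b / a - 1) * ∫ u in Ioc 0 a, φ u := by
    have : (b - a) * φ a = (b / a - 1) * (a * φ a) := by field_simp
    rw [this]
    exact mul_le_mul_of_nonneg_left h2 (by rw [sub_nonneg, le_div_iff₀ ha]; linarith)
  linarith

/-- Dyadic lower sums of the integral of a nonnegative decreasing function. -/
lemma sum_dyadic_le_setIntegral (hφ : IntegrableOn φ (Ioc 0 B)) (hmono : AntitoneOn φ (Ioc 0 B))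
    (h0 : ∀ u ∈ Ioc 0 B, 0 ≤ φ u) {δ : ℝ} (hδ : δ ∈ Ioc 0 B) (m : ℕ) :
    ∑ i ∈ Finset.range m, δ / 2 ^ i * φ (δ / 2 ^ i) ≤ 2 * ∫ u in Ioc 0 δ, φ u := by
  have hmem : ∀ i : ℕ, δ / 2 ^ i ∈ Ioc 0 B := fun i =>
    ⟨div_pos hδ.1 (by positivity),
      (div_le_self hδ.1.le (one_le_pow₀ (by norm_num))).trans hδ.2⟩
  have key : ∑ i ∈ Finset.range m, δ / 2 ^ i * φ (δ / 2 ^ i)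
      + 2 * ∫ u in Ioc 0 (δ / 2 ^ m), φ u ≤ 2 * ∫ u in Ioc 0 δ, φ u := by
    induction m with
    | zero => simp
    | succ m ih =>
      rw [Finset.sum_range_succ]
      have hlt : δ / 2 ^ (m + 1) ≤ δ / 2 ^ m := by
        rw [pow_succ, ← div_div]
        exact div_le_self (hmem m).1.le (by norm_num)
      have h1 := setIntegral_Ioc_sub hφ (hmem (m + 1)).1.le hlt (hmem m).2
      have h2 := sub_mul_le_setIntegral hφ hmono (hmem (m + 1)).1.le hlt (hmem m).2
      have h3 : δ / 2 ^ m - δ / 2 ^ (m + 1) = δ / 2 ^ m / 2 := by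
        rw [pow_succ]; field_simp; norm_num
      rw [h3] at h2
      linarith
  have : 0 ≤ ∫ u in Ioc 0 (δ / 2 ^ m), φ u :=
    setIntegral_nonneg measurableSet_Ioc fun u hu => h0 u ⟨hu.1, hu.2.trans (hmem m).2⟩
  linarith

end Antitone

/-! ### The operators -/

section Operators

variable {X Y : Type*} [MeasurableSpace X] [MeasurableSpace Y] {μ : Measure X} {ν : Measure Y}

lemma integral_sq_eq_eLpNorm_sq {h : X → ℝ} (hh : MemLp h 2 μ) :
    ∫ x, h x ^ 2 ∂μ = (eLpNorm h 2 μ).toReal ^ 2 := by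
  have h2 := hh.eLpNorm_eq_integral_rpow_norm (by norm_num) (by norm_num)
  have h0 : 0 ≤ ∫ x, h x ^ 2 ∂μ := integral_nonneg fun x => sq_nonneg _
  rw [h2, ENNReal.toReal_ofReal (by positivity)]
  simp only [ENNReal.toReal_ofNat, Real.rpow_ofNat, Real.norm_eq_abs, sq_abs]
  rw [← Real.rpow_natCast, ← Real.rpow_mul h0]
  norm_num

namespace L2Operator

variable (Q : L2Operator μ ν)

lemma map_zero : Q 0 = 0 := by
  have := Q.map_smul 0 0 Q.domain.zero_mem
  simpa using this

lemma map_sub {f g : X → ℝ} (hf : f ∈ Q.domain) (hg : g ∈ Q.domain) : Q (f - g) = Q f - Q g := by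
  have h := Q.map_add f hf _ (Q.domain.smul_mem (-1) hg)
  rw [Q.map_smul _ _ hg] at h
  simpa [sub_eq_add_neg] using h

lemma apply_le_apply (hQ : PreservesPositivity Q) {f g : X → ℝ} (hf : f ∈ Q.domain)
    (hg : g ∈ Q.domain) (h : ∀ x, f x ≤ g x) (y : Y) : Q f y ≤ Q g y := by
  have := hQ (g - f) (Q.domain.sub_mem hg hf) (fun x => sub_nonneg.2 (h x)) y
  rw [Q.map_sub hg hf] at this
  exact sub_nonneg.1 this

/-- On finite sets `opRatio` is a genuine operator bound: the supremum is bounded, and a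
quotient with vanishing denominator has a vanishing numerator. -/
lemma eLpNorm_le_opRatio {S T : Set (X → ℝ)} (hS : S.Finite) (hT : T.Finite)
    {f g : X → ℝ} (hf : f ∈ S) (hg : g ∈ T) (hfQ : f ∈ Q.domain) (hgQ : g ∈ Q.domain) :
    (eLpNorm (Q (f - g)) 2 ν).toReal ≤ opRatio Q S T * (eLpNorm (f - g) 2 μ).toReal := by
  have hdom := Q.domain.sub_mem hfQ hgQ
  by_cases h0 : (eLpNorm (f - g) 2 μ).toReal = 0
  · rw [h0, mul_zero]
    have hmem := Q.memLp_of_mem _ hdom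
    rw [ENNReal.toReal_eq_zero_iff, or_iff_left hmem.eLpNorm_ne_top,
      eLpNorm_eq_zero_iff hmem.aestronglyMeasurable (by norm_num)] at h0
    have h1 := Q.congr_ae _ hdom 0 Q.domain.zero_mem h0
    rw [Q.map_zero] at h1
    rw [eLpNorm_congr_ae h1]
    simp
  · have hpos : 0 < (eLpNorm (f - g) 2 μ).toReal := lt_of_le_of_ne ENNReal.toReal_nonneg (Ne.symm h0)
    rw [← div_le_iff₀ hpos]
    refine le_csSup ?_ ⟨f, hf, g, hg, ?_, rfl⟩
    · refine ((hS.prod hT).image fun z : (X → ℝ) × (X → ℝ) =>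
        (eLpNorm (Q (z.1 - z.2)) 2 ν).toReal / (eLpNorm (z.1 - z.2) 2 μ).toReal).bddAbove.mono ?_
      rintro _ ⟨f', hf', g', hg', -, rfl⟩
      exact ⟨(f', g'), ⟨hf', hg'⟩, rfl⟩
    · rintro rfl
      simp at h0

lemma eLpNorm_upper_sub_lower_le {net : ℝ → Finset ((X → ℝ) × (X → ℝ))} {δ : ℝ}
    (hdom : ∀ p ∈ net δ, p.1 ∈ Q.domain ∧ p.2 ∈ Q.domain)
    {p p' : (X → ℝ) × (X → ℝ)} (hp : p ∈ net δ) (hp' : p' ∈ net δ) :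
    (eLpNorm (Q p.2 - Q p'.1) 2 ν).toReal
      ≤ rhoDen Q net δ * (eLpNorm (p.2 - p'.1) 2 μ).toReal := by
  rw [← Q.map_sub (hdom p hp).2 (hdom p' hp').1]
  have hU : (upperFns (net δ)).Finite := ((net δ).finite_toSet.image Prod.snd).subset
    fun g ⟨r, hr, h⟩ => ⟨r, hr, h⟩
  have hL : (lowerFns (net δ)).Finite := ((net δ).finite_toSet.image Prod.fst).subset
    fun g ⟨r, hr, h⟩ => ⟨r, hr, h⟩
  refine (Q.eLpNorm_le_opRatio hU hL ⟨p, hp, rfl⟩ ⟨p', hp', rfl⟩ (hdom p hp).2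
    (hdom p' hp').1).trans ?_
  exact mul_le_mul_of_nonneg_right (le_max_left _ _) ENNReal.toReal_nonneg

end L2Operator

/-- The distribution with density `h` with respect to `ν`. -/
noncomputable abbrev densityLaw (ν : Measure Y) (h : Y → ℝ) : Measure Y :=
  ν.withDensity fun y => ENNReal.ofReal (h y)

lemma IsProbDensity.isProbabilityMeasure {h : Y → ℝ} (hh : IsProbDensity ν h) :
    IsProbabilityMeasure (densityLaw ν h) :=
  ⟨by rw [withDensity_apply _ MeasurableSet.univ, Measure.restrict_univ]; exact hh.2.2⟩

lemma densityLaw_le {h : Y → ℝ} {M : ℝ} (hM : ∀ᵐ y ∂ν, h y ≤ M) :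
    densityLaw ν h ≤ ENNReal.ofReal M • ν := by
  rw [← withDensity_const]
  exact withDensity_mono (hM.mono fun y hy => ENNReal.ofReal_le_ofReal hy)

lemma memLp_densityLaw {h k : Y → ℝ} {M : ℝ} (hM : ∀ᵐ y ∂ν, h y ≤ M) (hk : MemLp k 2 ν) :
    MemLp k 2 (densityLaw ν h) :=
  hk.of_measure_le_smul ENNReal.ofReal_ne_top (densityLaw_le hM)

lemma integral_sq_densityLaw_le {h k : Y → ℝ} {M : ℝ} (hM : ∀ᵐ y ∂ν, h y ≤ M) (hM0 : 0 ≤ M)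
    (hk : MemLp k 2 ν) :
    ∫ y, k y ^ 2 ∂(densityLaw ν h) ≤ M * (eLpNorm k 2 ν).toReal ^ 2 := by
  rw [← integral_sq_eq_eLpNorm_sq hk]
  calc _ ≤ ∫ y, k y ^ 2 ∂(ENNReal.ofReal M • ν) :=
        integral_mono_measure (densityLaw_le hM) (ae_of_all _ fun y => sq_nonneg _)
          (hk.integrable_sq.smul_measure ENNReal.ofReal_ne_top)
    _ = _ := by rw [integral_smul_measure, ENNReal.toReal_ofReal hM0, smul_eq_mul]

/-- Under the density `A f`, the variable `Q g` is an unbiased estimator of `∫ f g`. -/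
lemma integral_densityLaw_eq {A Q : L2Operator μ ν} (hAQ : IsAdjointOfInverse A Q) {f g : X → ℝ}
    (hf : f ∈ A.domain) (hg : g ∈ Q.domain) (hd : IsProbDensity ν (A f)) :
    ∫ y, Q g y ∂(densityLaw ν (A f)) = ∫ x, f x * g x ∂μ := by
  rw [hAQ.2 f hf g hg, integral_withDensity_eq_integral_toReal_smul₀ hd.1.ennreal_ofReal
    (ae_of_all _ fun y => ENNReal.ofReal_lt_top)]
  refine integral_congr_ae ?_
  filter_upwards [hd.2.1] with y hy
  rw [ENNReal.toReal_ofReal hy, smul_eq_mul]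

/-- The basic inequality of empirical risk minimization: the excess risk of `g` is
`‖g - f‖²` up to twice the empirical deviation of `Q g - Q f`. -/
lemma sq_eLpNorm_sub_le {A Q : L2Operator μ ν} (hAQ : IsAdjointOfInverse A Q) {f g : X → ℝ}
    (hfA : f ∈ A.domain) (hf : f ∈ Q.domain) (hg : g ∈ Q.domain) (hd : IsProbDensity ν (A f))
    {n : ℕ} {y : Fin n → Y} {ε : ℝ} (hε : empiricalRisk Q y g ≤ empiricalRisk Q y f + ε) :
    (eLpNorm (g - f) 2 μ).toReal ^ 2
      ≤ 2 * (empDev (densityLaw ν (A f)) y (Q g) - empDev (densityLaw ν (A f)) y (Q f)) + ε := by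
  have hf2 := Q.memLp_of_mem f hf
  have hg2 := Q.memLp_of_mem g hg
  rw [← integral_sq_eq_eLpNorm_sq (hg2.sub hf2)]
  have hfg : Integrable (fun x => f x * g x) μ := hf2.integrable_mul hg2
  have e1 : ∫ x, (g - f) x ^ 2 ∂μ
      = ∫ x, g x ^ 2 ∂μ - 2 * ∫ x, f x * g x ∂μ + ∫ x, f x * f x ∂μ := by
    have : ∀ x, (g - f) x ^ 2 = g x ^ 2 - 2 * (f x * g x) + f x * f x := fun x => by
      simp only [Pi.sub_apply]; ring
    simp_rw [this]
    have i1 : Integrable (fun x => g x ^ 2 - 2 * (f x * g x)) μ :=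
      hg2.integrable_sq.sub (hfg.const_mul 2)
    have i2 : Integrable (fun x => f x * f x) μ := hf2.integrable_mul hf2
    rw [integral_add i1 i2, integral_sub hg2.integrable_sq (hfg.const_mul 2),
      integral_const_mul]
  have e2 : ∫ x, f x ^ 2 ∂μ = ∫ x, f x * f x ∂μ := by simp_rw [pow_two]
  simp only [empDev, integral_densityLaw_eq hAQ hfA hg hd, integral_densityLaw_eq hAQ hfA hf hd]
  simp only [empiricalRisk] at hε
  linarith

end Operators

/-! ### Chaining at geometric scales -/

section Geometric

/-- Discrete integration by parts: for geometrically decreasing `s`, replacing `l` by its partial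
sums costs only a constant factor. -/
lemma sum_geometric_mul_sum_le {s l : ℕ → ℝ} {r : ℝ} (hr : 0 < r) (hr1 : r < 1)
    (hs : ∀ k, 0 ≤ s k) (hs1 : ∀ k, s (k + 1) = r * s k) (hl : ∀ k, 0 ≤ l k) (K : ℕ) :
    ∑ k ∈ Finset.range K, s k * ∑ i ∈ Finset.range (k + 2), l i
      ≤ (r * (1 - r))⁻¹ * ∑ i ∈ Finset.range (K + 2), s i * l i := by
  have h1r : 0 < 1 - r := sub_pos.2 hr1
  suffices h : ∑ k ∈ Finset.range K, s k * ∑ i ∈ Finset.range (k + 2), l i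
      + s K * (∑ i ∈ Finset.range (K + 2), l i) / (1 - r)
      ≤ (r * (1 - r))⁻¹ * ∑ i ∈ Finset.range (K + 2), s i * l i by
    have : 0 ≤ s K * (∑ i ∈ Finset.range (K + 2), l i) / (1 - r) :=
      div_nonneg (mul_nonneg (hs K) (Finset.sum_nonneg fun i _ => hl i)) h1r.le
    linarith
  induction K with
  | zero =>
    simp only [Finset.range_zero, Finset.sum_empty, zero_add, Finset.sum_range_succ, hs1]
    have h2 : s 0 * l 0 / (1 - r) ≤ s 0 * l 0 / (1 - r) / r :=
      le_div_self (div_nonneg (mul_nonneg (hs 0) (hl 0)) h1r.le) hr hr1.le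
    have h3 : (r * (1 - r))⁻¹ * (s 0 * l 0 + r * s 0 * l 1)
        = s 0 * l 0 / (1 - r) / r + s 0 * l 1 / (1 - r) := by
      field_simp
    rw [h3, mul_add, add_div]
    linarith
  | succ K ih =>
    rw [Finset.sum_range_succ, Finset.sum_range_succ _ (K + 2), Finset.sum_range_succ _ (K + 2),
      mul_add (r * (1 - r))⁻¹]
    have h4 : (r * (1 - r))⁻¹ * (s (K + 2) * l (K + 2)) = s (K + 1) * l (K + 2) / (1 - r) := by
      rw [hs1 (K + 1)]
      field_simp
    have h5 : s K * ∑ i ∈ Finset.range (K + 2), l i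
        + s (K + 1) * (∑ i ∈ Finset.range (K + 2), l i) / (1 - r)
        = s K * (∑ i ∈ Finset.range (K + 2), l i) / (1 - r) := by
      rw [hs1 K]
      field_simp
      ring
    have h6 : s (K + 1) * (∑ i ∈ Finset.range (K + 2), l i + l (K + 2)) / (1 - r)
        = s (K + 1) * (∑ i ∈ Finset.range (K + 2), l i) / (1 - r)
          + s (K + 1) * l (K + 2) / (1 - r) := by ring
    rw [h4, h6]
    linarith

lemma sum_geometric_le {s : ℕ → ℝ} {r : ℝ} (hr1 : r < 1)
    (hs : ∀ k, 0 ≤ s k) (hs1 : ∀ k, s (k + 1) = r * s k) (K : ℕ) :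
    ∑ k ∈ Finset.range K, s k ≤ s 0 / (1 - r) := by
  have h1r : 0 < 1 - r := sub_pos.2 hr1
  have h : ∑ k ∈ Finset.range K, s k = (s 0 - s K) / (1 - r) := by
    induction K with
    | zero => simp
    | succ K ih =>
      rw [Finset.sum_range_succ, ih, hs1]
      field_simp
      ring
  rw [h]
  have := hs K
  gcongr
  linarith

variable {Y : Type*} [MeasurableSpace Y]

/-- The chaining bound for brackets of geometrically decreasing size `σ r ^ k`, `σ = s₁ D`, with
the thresholds tuned so that the deterministic part is at most `δ²`. In the application
`D = δ ^ (1 - a)` and `E = δ ^ (1 + a)`. -/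
theorem exists_chaining_bound_geometric {ι α : Type*} {P : Measure Y} [IsProbabilityMeasure P]
    {n : ℕ} (hn : n ≠ 0) (q : ℕ → α → Y → ℝ) (p : ℕ → ι → α) (S : ℕ → Finset α)
    (hp : ∀ k g, p k g ∈ S k) (w : ι → Y → ℝ) (w₀ : Y → ℝ)
    (hq : ∀ k g, MemLp (q k (p k g)) 2 P) (hw : ∀ g, MemLp (w g) 2 P) (hw₀ : MemLp w₀ 2 P)
    (hle : ∀ k g y, w g y ≤ q k (p k g) y)
    {r s₁ V H η κ δ D E : ℝ} (hr : 0 < r) (hr1 : r < 1) (hs₁ : 0 < s₁) (hV : 0 < V)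
    (hκ : 0 < κ) (hδ : 0 < δ) (hD : 0 < D) (hE : 0 < E) (hDE : D * E = δ ^ 2)
    (hη1 : 2 * η / (r * (1 - r)) ≤ 1 / 4) (hη2 : η ^ 2 ≤ 1 / (128 * V)) (hη : 0 < η)
    (hκ1 : 2 * κ * s₁ / (1 - r) ≤ 1 / 4) (hκ2 : κ ^ 2 ≤ 1 / (128 * V * s₁ ^ 2))
    (hqs : ∀ k g, ∫ y, (q k (p k g) y - w g y) ^ 2 ∂P ≤ (s₁ * D * r ^ k) ^ 2)
    (hqv : ∀ g, ∫ y, (q 0 (p 0 g) y - w₀ y) ^ 2 ∂P ≤ V * (s₁ * D) ^ 2)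
    (hqH : ∀ g, ∀ᵐ y ∂P, q 0 (p 0 g) y - w₀ y ≤ H)
    (hH : δ ^ 2 / 4 * H ≤ 2 * (V * (s₁ * D) ^ 2))
    (hent : ∀ m, ∑ i ∈ Finset.range m, s₁ * D * r ^ i * √(Real.log (S i).card)
      ≤ η * √n * δ ^ 2) :
    ∃ W : (Fin n → Y) → ℝ, AEMeasurable W (Measure.pi fun _ => P) ∧ (∀ y, 0 ≤ W y) ∧
      ∫⁻ y, ENNReal.ofReal (W y) ∂(Measure.pi fun _ => P)
        ≤ ENNReal.ofReal ((8 * V * s₁ ^ 2 + s₁ / ((1 - r) * κ)) / κ ^ 2 * δ ^ 2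
          / (√n * E) ^ 4) ∧
      ∀ y g, empDev P y (w g) - empDev P y w₀ ≤ δ ^ 2 + W y := by
  have h1r : 0 < 1 - r := sub_pos.2 hr1
  have hn0 : (0 : ℝ) < n := by exact_mod_cast Nat.pos_of_ne_zero hn
  obtain ⟨N, hN⟩ : ∃ N, N = √(n : ℝ) := ⟨_, rfl⟩
  have hNpos : 0 < N := hN ▸ Real.sqrt_pos.2 hn0
  have hNsq : (n : ℝ) = N ^ 2 := by rw [hN, Real.sq_sqrt hn0.le]
  rw [← hN] at hent ⊢
  set s : ℕ → ℝ := fun k => s₁ * D * r ^ k with hs_def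
  set l : ℕ → ℝ := fun i => √(Real.log (S i).card) with hl_def
  have hspos : ∀ k, 0 < s k := fun k => by positivity
  have hs1 : ∀ k, s (k + 1) = r * s k := fun k => by simp only [hs_def]; ring
  have hl0 : ∀ i, 0 ≤ l i := fun i => Real.sqrt_nonneg _
  have hlsq : ∀ i, Real.log (S i).card = l i ^ 2 := fun i =>
    (Real.sq_sqrt (Real.log_natCast_nonneg _)).symm
  -- the square root of the extra exponent `x` in the exponential bounds
  set z : ℝ := κ * N * E with hz
  have hzpos : 0 < z := by positivity
  set t : ℕ → ℝ := fun k => match k with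
    | 0 => δ ^ 2 / 4
    | k + 1 => 2 * s k / N * (∑ i ∈ Finset.range (k + 2), l i + z) with ht_def
  have hSum0 : ∀ k, 0 ≤ ∑ i ∈ Finset.range k, l i := fun k => Finset.sum_nonneg fun i _ => hl0 i
  have ht0 : t 0 = δ ^ 2 / 4 := rfl
  have ht1 : ∀ k, t (k + 1) = 2 * s k / N * (∑ i ∈ Finset.range (k + 2), l i + z) := fun k => rfl
  have htpos : ∀ k, 0 < t k := by
    rintro (_ | k)
    · rw [ht0]; positivity
    · rw [ht1]
      have := hspos k
      have := hSum0 (k + 2)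
      positivity
  obtain ⟨K, hK⟩ : ∃ K, s K ≤ δ ^ 2 / 4 := by
    obtain ⟨K, hK⟩ := exists_pow_lt_of_lt_one (show 0 < δ ^ 2 / 4 / (s₁ * D) by positivity) hr1
    refine ⟨K, ?_⟩
    rw [lt_div_iff₀ (by positivity)] at hK
    simp only [hs_def]
    linarith
  obtain ⟨W, hWm, hW0, hWi, hW⟩ := exists_chaining_bound (P := P) hn q p S hp w w₀ hq hw hw₀ hle
    (s := s) (t := t) (v := V * (s₁ * D) ^ 2) (H := H) (x := z ^ 2) hspos htpos (by positivity)
    hqs hqv hqH (by rw [ht0]; exact hH)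
    (by
      rw [ht0, hlsq, hNsq]
      have h1 : s₁ * D * l 0 ≤ η * N * δ ^ 2 := by simpa [hs_def, hl_def] using hent 1
      have h2 : l 0 ≤ η * N * E / s₁ := by
        rw [le_div_iff₀ hs₁, ← mul_le_mul_iff_right₀ hD]
        calc D * (l 0 * s₁) = s₁ * D * l 0 := by ring
          _ ≤ η * N * δ ^ 2 := h1
          _ = D * (η * N * E) := by rw [← hDE]; ring
      have h3 : l 0 ^ 2 ≤ (N * E) ^ 2 / s₁ ^ 2 * (1 / (128 * V)) := by
        calc l 0 ^ 2 ≤ (η * N * E / s₁) ^ 2 := pow_le_pow_left₀ (hl0 0) h2 2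
          _ = (N * E) ^ 2 / s₁ ^ 2 * η ^ 2 := by ring
          _ ≤ _ := by gcongr
      have h4 : z ^ 2 ≤ (N * E) ^ 2 * (1 / (128 * V * s₁ ^ 2)) := by
        calc z ^ 2 = (N * E) ^ 2 * κ ^ 2 := by rw [hz]; ring
          _ ≤ _ := by gcongr
      have h5 : N ^ 2 * (δ ^ 2 / 4) ^ 2 / (4 * (V * (s₁ * D) ^ 2))
          = (N * E) ^ 2 / s₁ ^ 2 * (1 / (128 * V)) + (N * E) ^ 2 * (1 / (128 * V * s₁ ^ 2)) := by
        rw [← hDE]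
        field_simp
        norm_num
      rw [h5]
      linarith)
    (fun k => by
      have hsk := hspos k
      have h1 : (n : ℝ) * t (k + 1) ^ 2 / (4 * s k ^ 2)
          = (∑ i ∈ Finset.range (k + 2), l i + z) ^ 2 := by
        rw [ht1, hNsq]
        field_simp
        ring
      have h2 : ∑ i ∈ Finset.range (k + 2), l i ^ 2 ≤ (∑ i ∈ Finset.range (k + 2), l i) ^ 2 :=
        Finset.sum_sq_le_sq_sum_of_nonneg fun i _ => hl0 i
      rw [h1]
      simp_rw [hlsq]
      nlinarith [mul_nonneg (hSum0 (k + 2)) hzpos.le])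
    K
  have hgeo := sum_geometric_le hr1 (fun k => (hspos k).le) hs1 K
  have hs0 : s 0 = s₁ * D := by simp [hs_def]
  refine ⟨W, hWm, hW0, hWi.trans (ENNReal.ofReal_le_ofReal ?_), fun y g => (hW y g).trans ?_⟩
  · have h1 : ∑ k ∈ Finset.range K, 2 * s k ^ 2 / (n * t (k + 1))
        ≤ s₁ * D / (1 - r) / (N * z) := by
      calc _ ≤ ∑ k ∈ Finset.range K, s k / (N * z) := by
            refine Finset.sum_le_sum fun k _ => ?_
            have hsk := hspos k
            have hS := hSum0 (k + 2)
            have : 2 * s k ^ 2 / (n * t (k + 1))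
                = s k / (N * (∑ i ∈ Finset.range (k + 2), l i + z)) := by
              rw [ht1, hNsq]
              field_simp
            rw [this]
            gcongr
            linarith
        _ = (∑ k ∈ Finset.range K, s k) / (N * z) := by rw [Finset.sum_div]
        _ ≤ _ := by rw [← hs0]; gcongr
    -- a polynomial tail suffices for summing over the shells
    have h2 : Real.exp (-z ^ 2) ≤ 1 / z ^ 2 := by
      rw [Real.exp_neg, ← one_div]
      refine one_div_le_one_div_of_le (by positivity) ?_
      linarith [Real.add_one_le_exp (z ^ 2)]
    have hnn : 0 ≤ 2 * (V * (s₁ * D) ^ 2) / (n * t 0) + s₁ * D / (1 - r) / (N * z) := by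
      rw [ht0]; positivity
    calc _ ≤ Real.exp (-z ^ 2) *
          (2 * (V * (s₁ * D) ^ 2) / (n * t 0) + s₁ * D / (1 - r) / (N * z)) := by gcongr
      _ ≤ 1 / z ^ 2 * (2 * (V * (s₁ * D) ^ 2) / (n * t 0) + s₁ * D / (1 - r) / (N * z)) := by
          gcongr
      _ = _ := by
          rw [ht0, hNsq, hz, ← hDE]
          field_simp
          ring
  · have h1 : ∑ k ∈ Finset.range K, t (k + 1)
        ≤ 2 / N * ((r * (1 - r))⁻¹ * (η * N * δ ^ 2) + s₁ * D / (1 - r) * z) := by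
      calc ∑ k ∈ Finset.range K, t (k + 1)
          = 2 / N * (∑ k ∈ Finset.range K, s k * ∑ i ∈ Finset.range (k + 2), l i
              + (∑ k ∈ Finset.range K, s k) * z) := by
            rw [Finset.sum_mul, ← Finset.sum_add_distrib, Finset.mul_sum]
            refine Finset.sum_congr rfl fun k _ => ?_
            rw [ht1]
            ring
        _ ≤ _ := by
            gcongr
            · refine (sum_geometric_mul_sum_le hr hr1 (fun k => (hspos k).le) hs1 hl0 K).trans ?_
              gcongr
              exact hent (K + 2)
            · rw [← hs0]; exact hgeo
    have h2 : 2 / N * ((r * (1 - r))⁻¹ * (η * N * δ ^ 2) + s₁ * D / (1 - r) * z)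
        = (2 * η / (r * (1 - r)) + 2 * κ * s₁ / (1 - r)) * δ ^ 2 := by
      rw [hz, ← hDE]
      field_simp
    have h3 : (2 * η / (r * (1 - r)) + 2 * κ * s₁ / (1 - r)) * δ ^ 2 ≤ (1 / 4 + 1 / 4) * δ ^ 2 := by
      gcongr
    rw [ht0]
    linarith

end Geometric

/-! ### Deviations over a shell -/

section Shell

variable {X Y : Type*} [MeasurableSpace X] [MeasurableSpace Y] {μ : Measure X} {ν : Measure Y}

lemma toReal_eLpNorm_mono {g h : Y → ℝ} (hg : MemLp g 2 ν) (h' : ∀ y, |h y| ≤ |g y|) :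
    (eLpNorm h 2 ν).toReal ≤ (eLpNorm g 2 ν).toReal :=
  ENNReal.toReal_mono hg.eLpNorm_ne_top (eLpNorm_mono h')

/-- The sum of the absolute values of the images of all bracket functions: a common envelope of
the functions `Q g` for all `g` lying in one of the brackets. -/
noncomputable def bracketEnvelope (Q : L2Operator μ ν) (N : Finset ((X → ℝ) × (X → ℝ)))
    (y : Y) : ℝ :=
  ∑ p ∈ N, (|Q p.1 y| + |Q p.2 y|)

lemma memLp_bracketEnvelope {Q : L2Operator μ ν} {N : Finset ((X → ℝ) × (X → ℝ))}
    (hN : ∀ p ∈ N, p.1 ∈ Q.domain ∧ p.2 ∈ Q.domain) : MemLp (bracketEnvelope Q N) 2 ν :=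
  memLp_finsetSum _ fun p hp =>
    (Q.memLp_apply _ (hN p hp).1).abs.add (Q.memLp_apply _ (hN p hp).2).abs

lemma abs_apply_le_bracketEnvelope {Q : L2Operator μ ν} (hQ : PreservesPositivity Q)
    {N : Finset ((X → ℝ) × (X → ℝ))} (hN : ∀ p ∈ N, p.1 ∈ Q.domain ∧ p.2 ∈ Q.domain)
    {g : X → ℝ} (hg : g ∈ Q.domain) {p : (X → ℝ) × (X → ℝ)} (hp : p ∈ N)
    (hpg : ∀ x, p.1 x ≤ g x ∧ g x ≤ p.2 x) (y : Y) : |Q g y| ≤ bracketEnvelope Q N y := by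
  have h1 : |Q p.1 y| + |Q p.2 y| ≤ bracketEnvelope Q N y :=
    Finset.single_le_sum (f := fun p : (X → ℝ) × (X → ℝ) => |Q p.1 y| + |Q p.2 y|)
      (fun p _ => by positivity) hp
  have h2 := Q.apply_le_apply hQ (hN p hp).1 hg (fun x => (hpg x).1) y
  have h3 := Q.apply_le_apply hQ hg (hN p hp).2 (fun x => (hpg x).2) y
  refine abs_le.2 ⟨?_, ?_⟩
  · linarith [neg_abs_le (Q p.1 y), abs_nonneg (Q p.2 y)]
  · linarith [le_abs_self (Q p.2 y), abs_nonneg (Q p.1 y)]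

lemma bracketEnvelope_ae_le {Q : L2Operator μ ν} {N : Finset ((X → ℝ) × (X → ℝ))} {b : ℝ}
    (hb : ∀ p ∈ N, (∀ᵐ y ∂ν, |Q p.1 y| ≤ b) ∧ ∀ᵐ y ∂ν, |Q p.2 y| ≤ b) :
    ∀ᵐ y ∂ν, bracketEnvelope Q N y ≤ N.card * (b + b) := by
  have h : ∀ᵐ y ∂ν, ∀ p ∈ N, |Q p.1 y| + |Q p.2 y| ≤ b + b := by
    rw [Filter.eventually_all_finset]
    intro p hp
    filter_upwards [(hb p hp).1, (hb p hp).2] with y h1 h2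
    exact add_le_add h1 h2
  filter_upwards [h] with y hy
  rw [← nsmul_eq_mul]
  exact Finset.sum_le_card_nsmul _ _ _ hy

/-- The image of a bracket of size `δ` has size at most `ϱ(δ) δ`. -/
lemma eLpNorm_image_bracket_le {Q : L2Operator μ ν} {F : Set (X → ℝ)}
    {net : ℝ → Finset ((X → ℝ) × (X → ℝ))} {δ : ℝ} (hδ : 0 ≤ δ)
    (hnet : IsBracketingNet μ F δ (net δ))
    (hdom : ∀ p ∈ net δ, p.1 ∈ Q.domain ∧ p.2 ∈ Q.domain) (hρ : 0 ≤ rhoDen Q net δ)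
    {p : (X → ℝ) × (X → ℝ)} (hp : p ∈ net δ) :
    (eLpNorm (Q p.2 - Q p.1) 2 ν).toReal ≤ rhoDen Q net δ * δ := by
  refine (Q.eLpNorm_upper_sub_lower_le hdom hp hp).trans (mul_le_mul_of_nonneg_left ?_ hρ)
  rw [eLpNorm_sub_comm]
  exact ENNReal.toReal_le_of_le_ofReal hδ (hnet.1 p hp).2.2

/-- Two brackets of size `δ` around functions at distance at most `4 δ`: the upper function of one
is at distance at most `6 δ` from the lower function of the other. -/
lemma eLpNorm_upper_sub_lower_le_of_near {F : Set (X → ℝ)} {N : Finset ((X → ℝ) × (X → ℝ))} {δ : ℝ}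
    (hδ : 0 ≤ δ) (hN : IsBracketingNet μ F δ N) {f g : X → ℝ} (hf : MemLp f 2 μ)
    (hg : MemLp g 2 μ) (hgf : eLpNorm (g - f) 2 μ ≤ ENNReal.ofReal (4 * δ))
    {p p' : (X → ℝ) × (X → ℝ)} (hp : p ∈ N) (hp' : p' ∈ N)
    (hpg : ∀ x, p.1 x ≤ g x ∧ g x ≤ p.2 x) (hpf : ∀ x, p'.1 x ≤ f x ∧ f x ≤ p'.2 x) :
    (eLpNorm (p.2 - p'.1) 2 μ).toReal ≤ 6 * δ := by
  have h1 : eLpNorm (p.2 - g) 2 μ ≤ ENNReal.ofReal δ := by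
    refine le_trans (eLpNorm_mono fun x => ?_) (hN.1 p hp).2.2
    have := hpg x
    simp only [Pi.sub_apply, Real.norm_eq_abs]
    rw [abs_of_nonneg (by linarith), abs_of_nonpos (by linarith)]
    linarith
  have h2 : eLpNorm (f - p'.1) 2 μ ≤ ENNReal.ofReal δ := by
    refine le_trans (eLpNorm_mono fun x => ?_) (hN.1 p' hp').2.2
    have := hpf x
    simp only [Pi.sub_apply, Real.norm_eq_abs]
    rw [abs_of_nonneg (by linarith), abs_of_nonpos (by linarith)]
    linarith
  refine ENNReal.toReal_le_of_le_ofReal (by positivity) ?_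
  have e : p.2 - p'.1 = (p.2 - g) + ((g - f) + (f - p'.1)) := by abel
  have mp := (hN.1 p hp).2.1
  have mp' := (hN.1 p' hp').1
  rw [e]
  calc _ ≤ eLpNorm (p.2 - g) 2 μ + (eLpNorm (g - f) 2 μ + eLpNorm (f - p'.1) 2 μ) :=
        (eLpNorm_add_le (mp.sub hg).1 ((hg.sub hf).add (hf.sub mp')).1 one_le_two).trans
          (add_le_add le_rfl (eLpNorm_add_le (hg.sub hf).1 (hf.sub mp').1 one_le_two))
    _ ≤ ENNReal.ofReal δ + (ENNReal.ofReal (4 * δ) + ENNReal.ofReal δ) := by gcongr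
    _ = ENNReal.ofReal (6 * δ) := by
        rw [← ENNReal.ofReal_add (by positivity) hδ, ← ENNReal.ofReal_add hδ (by positivity)]
        congr 1
        ring

/-- The empirical deviations of `Q g - Q f` over all `g` with `‖g - f‖ ≤ 4 δ` exceed `δ²` by an
amount of small expectation, provided `δ` is large compared to the entropy integral. -/
theorem exists_shell_bound {A Q : L2Operator μ ν} {F : Set (X → ℝ)}
    (hFQ : ∀ f ∈ F, f ∈ Q.domain) {B₂ : ℝ} (hB₂ : 0 < B₂)
    {net : ℝ → Finset ((X → ℝ) × (X → ℝ))}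
    (hnet : ∀ δ, 0 < δ → IsBracketingNet μ F δ (net δ))
    (hnetQ : ∀ δ, 0 < δ → ∀ p ∈ net δ, p.1 ∈ Q.domain ∧ p.2 ∈ Q.domain)
    {a c : ℝ} (ha : 0 ≤ a) (ha1 : a < 1) (hc : 0 < c)
    (h1 : IntegrableOn (entropyIntegrand Q net) (Ioc 0 B₂))
    (h3 : ∀ δ ∈ Ioc 0 B₂, rhoDen Q net δ = c * δ ^ (-a))
    (h5 : AntitoneOn (entropyIntegrand Q net) (Ioc 0 B₂))
    {M : ℝ} (hM : 0 < M) (hMA : ∀ f ∈ F, ∀ᵐ y ∂ν, A f y ≤ M)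
    {b : ℝ} (hb0 : 0 ≤ b)
    (hb : ∀ p ∈ net B₂, (∀ᵐ y ∂ν, |Q p.1 y| ≤ b) ∧ ∀ᵐ y ∂ν, |Q p.2 y| ≤ b)
    (hQpos : PreservesPositivity Q) :
    ∃ η : ℝ, 0 < η ∧ ∃ E₁ : ℝ, 0 < E₁ ∧ ∀ n : ℕ, n ≠ 0 → ∀ δ ∈ Ioc 0 B₂,
      2 * √M * entropyIntegral Q net δ ≤ η * √n * δ ^ 2 → ∀ f ∈ F, IsProbDensity ν (A f) →
      ∃ W : (Fin n → Y) → ℝ, AEMeasurable W (sampleLaw ν (A f) n) ∧ (∀ y, 0 ≤ W y) ∧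
        ∫⁻ y, ENNReal.ofReal (W y) ∂(sampleLaw ν (A f) n)
          ≤ ENNReal.ofReal (E₁ * δ ^ 2 / (√n * δ ^ (1 + a)) ^ 4) ∧
        ∀ y, ∀ g ∈ F, eLpNorm (g - f) 2 μ ≤ ENNReal.ofReal (4 * δ) →
          empDev (densityLaw ν (A f)) y (Q g) - empDev (densityLaw ν (A f)) y (Q f)
            ≤ δ ^ 2 + W y := by
  obtain ⟨r, hr_def⟩ : ∃ r : ℝ, r = 2 ^ (a - 1) := ⟨_, rfl⟩
  have hr : 0 < r := by rw [hr_def]; positivity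
  have hr1 : r < 1 := by
    rw [hr_def]; exact Real.rpow_lt_one_of_one_lt_of_neg (by norm_num) (by linarith)
  have h1r : 0 < 1 - r := sub_pos.2 hr1
  obtain ⟨H, hH_def⟩ : ∃ H : ℝ, H = 2 * ((net B₂).card * (b + b)) := ⟨_, rfl⟩
  have hH0 : 0 ≤ H := by rw [hH_def]; positivity
  obtain ⟨s₁, hs₁_def⟩ : ∃ s₁ : ℝ, s₁ = √M * c := ⟨_, rfl⟩
  have hMs : 0 < √M := Real.sqrt_pos.2 hM
  have hs₁ : 0 < s₁ := by rw [hs₁_def]; positivity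
  obtain ⟨V, hV_def⟩ : ∃ V : ℝ, V = 144 + H * B₂ ^ (2 * a) / s₁ ^ 2 := ⟨_, rfl⟩
  have hV144 : 144 ≤ V := by
    rw [hV_def]
    have : 0 ≤ H * B₂ ^ (2 * a) / s₁ ^ 2 := by positivity
    linarith
  have hV : 0 < V := by linarith
  obtain ⟨η, hη, hη1, hη2⟩ : ∃ η : ℝ, 0 < η ∧ 2 * η / (r * (1 - r)) ≤ 1 / 4 ∧
      η ^ 2 ≤ 1 / (128 * V) := by
    refine ⟨min (r * (1 - r) / 8) (√(1 / (128 * V))), lt_min (by positivity) (by positivity),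
      ?_, ?_⟩
    · rw [div_le_iff₀ (by positivity)]
      linarith [min_le_left (r * (1 - r) / 8) (√(1 / (128 * V)))]
    · rw [← Real.le_sqrt (le_min (by positivity) (by positivity))]
      · exact min_le_right _ _
      · positivity
  obtain ⟨κ, hκ, hκ1, hκ2⟩ : ∃ κ : ℝ, 0 < κ ∧ 2 * κ * s₁ / (1 - r) ≤ 1 / 4 ∧
      κ ^ 2 ≤ 1 / (128 * V * s₁ ^ 2) := by
    refine ⟨min ((1 - r) / s₁ / 8) (√(1 / (128 * V * s₁ ^ 2))),
      lt_min (by positivity) (by positivity), ?_, ?_⟩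
    · rw [div_le_iff₀ (by positivity)]
      calc _ ≤ 2 * ((1 - r) / s₁ / 8) * s₁ := by gcongr; exact min_le_left _ _
        _ = _ := by field_simp; norm_num
    · rw [← Real.le_sqrt (le_min (by positivity) (by positivity))]
      · exact min_le_right _ _
      · positivity
  refine ⟨η, hη, (8 * V * s₁ ^ 2 + s₁ / ((1 - r) * κ)) / κ ^ 2, by positivity,
    fun n hn δ hδ hG f hf hd => ?_⟩
  have : IsProbabilityMeasure (densityLaw ν (A f)) := hd.isProbabilityMeasure
  have hac : densityLaw ν (A f) ≪ ν := withDensity_absolutelyContinuous _ _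
  have hδ0 : 0 < δ := hδ.1
  have hMf := hMA f hf
  have hQf := Q.memLp_apply f (hFQ f hf)
  -- the dyadic levels
  have hlev : ∀ k : ℕ, δ / 2 ^ k ∈ Ioc 0 B₂ := fun k => ⟨by positivity,
    (div_le_self hδ0.le (one_le_pow₀ (by norm_num))).trans hδ.2⟩
  have hρ : ∀ u ∈ Ioc 0 B₂, rhoDen Q net u * u = c * u ^ (1 - a) := fun u hu => by
    rw [h3 u hu, mul_assoc, ← Real.rpow_add_one hu.1.ne']
    congr 2
    ring
  have hρ0 : ∀ u ∈ Ioc 0 B₂, 0 ≤ rhoDen Q net u := fun u hu => by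
    rw [h3 u hu]
    have := hu.1
    positivity
  have hpow : ∀ k : ℕ, (δ / 2 ^ k) ^ (1 - a) = δ ^ (1 - a) * r ^ k := fun k => by
    rw [Real.div_rpow hδ0.le (by positivity), div_eq_mul_inv, ← Real.rpow_neg (by positivity),
      ← Real.rpow_natCast 2 k, ← Real.rpow_mul (by norm_num), hr_def, ← Real.rpow_natCast,
      ← Real.rpow_mul (by norm_num)]
    congr 2
    ring
  have hscale : ∀ k : ℕ, √M * (rhoDen Q net (δ / 2 ^ k) * (δ / 2 ^ k))
      = s₁ * δ ^ (1 - a) * r ^ k := fun k => by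
    rw [hρ _ (hlev k), hpow, hs₁_def]
    ring
  have hmem : ∀ k : ℕ, ∀ g : X → ℝ, ∃ p : (X → ℝ) × (X → ℝ), g ∈ F →
      p ∈ net (δ / 2 ^ k) ∧ ∀ x, p.1 x ≤ g x ∧ g x ≤ p.2 x := fun k g => by
    by_cases hg : g ∈ F
    · obtain ⟨p, hp, h⟩ := (hnet _ (hlev k).1).2 g hg
      exact ⟨p, fun _ => ⟨hp, h⟩⟩
    · exact ⟨0, fun h => absurd h hg⟩
  choose br hbr using hmem
  set env : Y → ℝ := bracketEnvelope Q (net B₂) with henv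
  have henv2 : MemLp env 2 ν := memLp_bracketEnvelope (hnetQ B₂ hB₂)
  have henvle : ∀ g ∈ F, ∀ y, |Q g y| ≤ env y := fun g hg y => by
    obtain ⟨p, hp, h⟩ := (hnet B₂ hB₂).2 g hg
    exact abs_apply_le_bracketEnvelope hQpos (hnetQ B₂ hB₂) (hFQ g hg) hp h y
  have henvae : ∀ᵐ y ∂ν, 2 * env y ≤ H := by
    filter_upwards [bracketEnvelope_ae_le hb] with y hy
    rw [hH_def]
    linarith
  let ι := {g : X → ℝ // g ∈ F ∧ eLpNorm (g - f) 2 μ ≤ ENNReal.ofReal (4 * δ)}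
  -- the envelope comes from the brackets of size `B₂`: the images of finer brackets need not be
  -- bounded, so they are cut off at `env`
  set q : ℕ → (X → ℝ) × (X → ℝ) → Y → ℝ := fun _ p => Q p.2 ⊓ env with hq_def
  have hdom : ∀ k : ℕ, ∀ g ∈ F, (br k g).1 ∈ Q.domain ∧ (br k g).2 ∈ Q.domain :=
    fun k g hg => hnetQ _ (hlev k).1 _ (hbr k g hg).1
  have hlow : ∀ k : ℕ, ∀ g ∈ F, ∀ y, Q (br k g).1 y ≤ Q g y := fun k g hg y =>
    Q.apply_le_apply hQpos (hdom k g hg).1 (hFQ g hg) (fun x => ((hbr k g hg).2 x).1) y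
  have hupp : ∀ k : ℕ, ∀ g ∈ F, ∀ y, Q g y ≤ Q (br k g).2 y := fun k g hg y =>
    Q.apply_le_apply hQpos (hFQ g hg) (hdom k g hg).2 (fun x => ((hbr k g hg).2 x).2) y
  have hq2 : ∀ k : ℕ, ∀ g ∈ F, MemLp (q k (br k g)) 2 ν := fun k g hg =>
    (Q.memLp_apply _ (hdom k g hg).2).inf henv2
  have hqge : ∀ k : ℕ, ∀ g ∈ F, ∀ y, Q g y ≤ q k (br k g) y := fun k g hg y =>
    le_inf (hupp k g hg y) ((le_abs_self _).trans (henvle g hg y))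
  have hqle : ∀ k : ℕ, ∀ g y, q k (br k g) y ≤ Q (br k g).2 y := fun k g y => inf_le_left
  have hDE : δ ^ (1 - a) * δ ^ (1 + a) = δ ^ 2 := by
    rw [← Real.rpow_add hδ0, ← Real.rpow_natCast]
    congr 1
    push_cast
    ring
  obtain ⟨W, hW1, hW2, hW3, hW4⟩ := exists_chaining_bound_geometric (P := densityLaw ν (A f)) hn q
    (fun k (g : ι) => br k g.1) (fun k => net (δ / 2 ^ k)) (fun k g => (hbr k g.1 g.2.1).1)
    (fun g => Q g.1) (Q f)
    (fun k g => memLp_densityLaw hMf (hq2 k g.1 g.2.1))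
    (fun g => memLp_densityLaw hMf (Q.memLp_apply _ (hFQ _ g.2.1)))
    (memLp_densityLaw hMf hQf) (fun k g y => hqge k g.1 g.2.1 y)
    (r := r) (s₁ := s₁) (V := V) (H := H) (η := η) (κ := κ) (δ := δ) (D := δ ^ (1 - a))
    (E := δ ^ (1 + a)) hr hr1 hs₁ hV hκ hδ0 (by positivity) (by positivity)
    hDE hη1 hη2 hη hκ1 hκ2
    (fun k g => by
      obtain ⟨g, hg, -⟩ := g
      have hg2 := Q.memLp_apply _ (hFQ g hg)
      refine (integral_sq_densityLaw_le hMf hM.le ((hq2 k g hg).sub hg2)).trans ?_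
      rw [← hscale k, mul_pow, Real.sq_sqrt hM.le]
      refine mul_le_mul_of_nonneg_left (pow_le_pow_left₀ ENNReal.toReal_nonneg ?_ 2) hM.le
      refine le_trans (toReal_eLpNorm_mono ((Q.memLp_apply _ (hdom k g hg).2).sub
        (Q.memLp_apply _ (hdom k g hg).1)) fun y => ?_)
        (eLpNorm_image_bracket_le (hlev k).1.le (hnet _ (hlev k).1) (hnetQ _ (hlev k).1)
          (hρ0 _ (hlev k)) (hbr k g hg).1)
      have e1 := hqge k g hg y
      have e2 := hqle k g y
      have e3 := hlow k g hg y
      simp only [Pi.sub_apply]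
      rw [abs_of_nonneg (by linarith), abs_of_nonneg (by linarith)]
      linarith)
    (fun g => by
      obtain ⟨g, hg, hgf⟩ := g
      have hδ1 : δ / 2 ^ 0 = δ := by simp
      have hb1 := hbr 0 g hg
      have hb2 := hbr 0 f hf
      rw [hδ1] at hb1 hb2
      have m1 := (Q.memLp_apply _ (hdom 0 g hg).2).sub (Q.memLp_apply _ (hdom 0 f hf).1)
      have m2 := (Q.memLp_apply _ (hdom 0 f hf).2).sub (Q.memLp_apply _ (hdom 0 g hg).1)
      have n1 : (eLpNorm (Q (br 0 g).2 - Q (br 0 f).1) 2 ν).toReal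
          ≤ rhoDen Q net δ * (6 * δ) :=
        (Q.eLpNorm_upper_sub_lower_le (hnetQ δ hδ0) hb1.1 hb2.1).trans
          (mul_le_mul_of_nonneg_left (eLpNorm_upper_sub_lower_le_of_near hδ0.le (hnet δ hδ0)
            (Q.memLp_of_mem _ (hFQ f hf)) (Q.memLp_of_mem _ (hFQ g hg)) hgf hb1.1 hb2.1
            hb1.2 hb2.2) (hρ0 δ hδ))
      have n2 : (eLpNorm (Q (br 0 f).2 - Q (br 0 g).1) 2 ν).toReal
          ≤ rhoDen Q net δ * (6 * δ) :=
        (Q.eLpNorm_upper_sub_lower_le (hnetQ δ hδ0) hb2.1 hb1.1).trans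
          (mul_le_mul_of_nonneg_left (eLpNorm_upper_sub_lower_le_of_near hδ0.le (hnet δ hδ0)
            (Q.memLp_of_mem _ (hFQ g hg)) (Q.memLp_of_mem _ (hFQ f hf))
            (by rwa [eLpNorm_sub_comm]) hb2.1 hb1.1 hb2.2 hb1.2) (hρ0 δ hδ))
      have n3 : (eLpNorm (q 0 (br 0 g) - Q f) 2 ν).toReal ≤ rhoDen Q net δ * (12 * δ) := by
        set S := Q (br 0 g).2 - Q (br 0 f).1 with hS
        set T := Q (br 0 f).2 - Q (br 0 g).1 with hT
        calc _ ≤ (eLpNorm ((fun y => ‖S y‖) + fun y => ‖T y‖) 2 ν).toReal := by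
              refine toReal_eLpNorm_mono (m1.norm.add m2.norm) fun y => ?_
              have e1 := hqge 0 g hg y
              have e2 := hqle 0 g y
              have e3 := hlow 0 g hg y
              have e4 := hlow 0 f hf y
              have e5 := hupp 0 f hf y
              have e6 := le_abs_self (S y)
              have e7 := le_abs_self (T y)
              have e8 := abs_nonneg (S y)
              have e9 := abs_nonneg (T y)
              have eS : S y = Q (br 0 g).2 y - Q (br 0 f).1 y := rfl
              have eT : T y = Q (br 0 f).2 y - Q (br 0 g).1 y := rfl
              simp only [Pi.sub_apply, Pi.add_apply, Real.norm_eq_abs]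
              refine (abs_le.2 ⟨?_, ?_⟩).trans (le_abs_self _) <;> linarith
          _ ≤ (eLpNorm S 2 ν).toReal + (eLpNorm T 2 ν).toReal := by
              rw [← ENNReal.toReal_add m1.eLpNorm_ne_top m2.eLpNorm_ne_top, ← eLpNorm_norm S,
                ← eLpNorm_norm T]
              exact ENNReal.toReal_mono (ENNReal.add_ne_top.2
                ⟨m1.norm.eLpNorm_ne_top, m2.norm.eLpNorm_ne_top⟩)
                (eLpNorm_add_le m1.norm.1 m2.norm.1 one_le_two)
          _ ≤ _ := by linarith
      refine (integral_sq_densityLaw_le hMf hM.le ((hq2 0 g hg).sub hQf)).trans ?_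
      have hs := hscale 0
      rw [hδ1, pow_zero, mul_one] at hs
      calc _ ≤ M * (rhoDen Q net δ * (12 * δ)) ^ 2 :=
            mul_le_mul_of_nonneg_left (pow_le_pow_left₀ ENNReal.toReal_nonneg n3 2) hM.le
        _ = 144 * (√M * (rhoDen Q net δ * δ)) ^ 2 := by
            rw [mul_pow (√M), Real.sq_sqrt hM.le]; ring
        _ ≤ _ := by rw [hs]; gcongr)
    (fun g => by
      refine hac.ae_le ?_
      filter_upwards [henvae] with y hy
      have e1 : q 0 (br 0 g.1) y ≤ env y := inf_le_right
      have e2 := neg_abs_le (Q f y)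
      have e3 := henvle f hf y
      linarith)
    (by
      have hpow2 : δ ^ (2 * a) ≤ B₂ ^ (2 * a) :=
        Real.rpow_le_rpow hδ0.le hδ.2 (by positivity)
      have e1 : δ ^ 2 = (δ ^ (1 - a)) ^ 2 * δ ^ (2 * a) := by
        rw [← Real.rpow_natCast (δ ^ (1 - a)), ← Real.rpow_mul hδ0.le, ← Real.rpow_add hδ0,
          ← Real.rpow_natCast]
        congr 1
        push_cast
        ring
      have e2 : H * B₂ ^ (2 * a) ≤ V * s₁ ^ 2 := by
        rw [hV_def, add_mul, div_mul_cancel₀ _ (by positivity)]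
        have : 0 < s₁ ^ 2 := by positivity
        linarith
      calc δ ^ 2 / 4 * H = (δ ^ (1 - a)) ^ 2 * (H * δ ^ (2 * a)) / 4 := by rw [e1]; ring
        _ ≤ (δ ^ (1 - a)) ^ 2 * (H * B₂ ^ (2 * a)) / 4 := by gcongr
        _ ≤ (δ ^ (1 - a)) ^ 2 * (V * s₁ ^ 2) / 4 := by gcongr
        _ ≤ 2 * (V * (s₁ * δ ^ (1 - a)) ^ 2) := by
          have : 0 ≤ (δ ^ (1 - a)) ^ 2 * (V * s₁ ^ 2) := by positivity
          rw [mul_pow]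
          linarith)
    (fun m => by
      have e : ∀ i : ℕ, s₁ * δ ^ (1 - a) * r ^ i * √(Real.log ((net (δ / 2 ^ i)).card : ℝ))
          = √M * (δ / 2 ^ i * entropyIntegrand Q net (δ / 2 ^ i)) := fun i => by
        rw [← hscale i, entropyIntegrand]
        ring
      simp_rw [e]
      rw [← Finset.mul_sum]
      have h0 : ∀ u ∈ Ioc 0 B₂, 0 ≤ entropyIntegrand Q net u := fun u hu =>
        mul_nonneg (hρ0 u hu) (Real.sqrt_nonneg _)
      calc _ ≤ √M * (2 * entropyIntegral Q net δ) :=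
            mul_le_mul_of_nonneg_left (sum_dyadic_le_setIntegral h1 h5 h0 hδ m) hMs.le
        _ = 2 * √M * entropyIntegral Q net δ := by ring
        _ ≤ _ := hG)
  exact ⟨W, hW1, hW2, hW3, fun y g hg hgf => hW4 y ⟨g, hg, hgf⟩⟩

end Shell

/-! ### The risk bound -/

section Main

lemma ae_abs_le_of_eLpNorm_top_le {Y : Type*} [MeasurableSpace Y] {ν : Measure Y} {h : Y → ℝ}
    {b : ENNReal} (hb : b ≠ ⊤) (h' : eLpNorm h ⊤ ν ≤ b) : ∀ᵐ y ∂ν, |h y| ≤ b.toReal := by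
  rw [eLpNorm_exponent_top] at h'
  filter_upwards [ae_le_eLpNormEssSup (f := h) (μ := ν)] with y hy
  rw [← Real.norm_eq_abs, ← toReal_enorm]
  exact ENNReal.toReal_mono hb (hy.trans h')

/-- Peeling: if on each shell `2 δ ≤ D ≤ 4 δ` the quantity `D²` is at most `2 (δ² + W) + ε` with an
excess `W` whose expectation decays fast enough in `δ`, then `D²` has expectation of order
`δ₀² + ε`. -/
lemma lintegral_sq_le_of_shells {Ω : Type*} [MeasurableSpace Ω] {P : Measure Ω}
    [IsProbabilityMeasure P] {D : Ω → ENNReal} {B δ₀ e ε : ℝ} (hδ₀ : 0 < δ₀) (he : 0 ≤ e)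
    (hε : 0 < ε) (hDB : ∀ y, D y ≤ ENNReal.ofReal (2 * B))
    (hshell : ∀ j : ℕ, 2 ^ j * δ₀ ≤ B → ∃ W : Ω → ℝ, AEMeasurable W P ∧ (∀ y, 0 ≤ W y) ∧
      ∫⁻ y, ENNReal.ofReal (W y) ∂P ≤ ENNReal.ofReal (e / 2 ^ j) ∧
      ∀ y, (D y).toReal ≤ 4 * (2 ^ j * δ₀) →
        (D y).toReal ^ 2 ≤ 2 * ((2 ^ j * δ₀) ^ 2 + W y) + ε) :
    ∫⁻ y, D y ^ 2 ∂P ≤ ENNReal.ofReal (4 * δ₀ ^ 2 + 8 * e + 2 * ε) := by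
  have hshell' : ∀ j : ℕ, ∃ W : Ω → ℝ, AEMeasurable W P ∧ (∀ y, 0 ≤ W y) ∧
      ∫⁻ y, ENNReal.ofReal (W y) ∂P ≤ ENNReal.ofReal (e / 2 ^ j) ∧
      (2 ^ j * δ₀ ≤ B → ∀ y, (D y).toReal ≤ 4 * (2 ^ j * δ₀) →
        (D y).toReal ^ 2 ≤ 2 * ((2 ^ j * δ₀) ^ 2 + W y) + ε) := fun j => by
    by_cases hj : 2 ^ j * δ₀ ≤ B
    · obtain ⟨W, w1, w2, w3, w4⟩ := hshell j hj
      exact ⟨W, w1, w2, w3, fun _ => w4⟩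
    · exact ⟨fun _ => 0, aemeasurable_const, fun _ => le_rfl, by simp, fun h => absurd h hj⟩
  choose W hWm hW0 hWi hW using hshell'
  have hpt : ∀ y, D y ^ 2 ≤ ENNReal.ofReal (4 * δ₀ ^ 2 + 2 * ε)
      + ∑' j, ENNReal.ofReal (4 * W j y) := by
    intro y
    have hfin : D y ≠ ⊤ := ((hDB y).trans_lt ENNReal.ofReal_lt_top).ne
    set x := (D y).toReal with hx
    have hx0 : 0 ≤ x := ENNReal.toReal_nonneg
    have hDx : D y ^ 2 = ENNReal.ofReal (x ^ 2) := by
      rw [ENNReal.ofReal_pow hx0, hx, ENNReal.ofReal_toReal hfin]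
    rw [hDx]
    rcases le_or_gt x (2 * δ₀) with hle | hgt
    · refine le_trans (ENNReal.ofReal_le_ofReal ?_) le_self_add
      nlinarith
    · obtain ⟨j, hj1, hj2⟩ := exists_nat_pow_near (x := x / (2 * δ₀)) (y := 2)
        ((one_le_div (by positivity)).2 hgt.le) (by norm_num)
      rw [le_div_iff₀ (by positivity)] at hj1
      rw [div_lt_iff₀ (by positivity), pow_succ] at hj2
      have hB : 2 ^ j * δ₀ ≤ B := by
        rcases le_or_gt 0 B with hB0 | hB0
        · have : x ≤ 2 * B := ENNReal.toReal_le_of_le_ofReal (by positivity) (hDB y)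
          linarith
        · have h0 := hDB y
          rw [ENNReal.ofReal_of_nonpos (by linarith), nonpos_iff_eq_zero] at h0
          have : x = 0 := by rw [hx, h0, ENNReal.toReal_zero]
          linarith
      have h1 := hW j hB y (by rw [← hx]; linarith)
      rw [← hx] at h1
      have h2 : x ^ 2 ≤ (4 * δ₀ ^ 2 + 2 * ε) + 4 * W j y := by
        have h4 : (2 * (2 ^ j * δ₀)) ^ 2 ≤ x ^ 2 :=
          pow_le_pow_left₀ (by positivity) (by linarith) 2
        nlinarith [sq_nonneg δ₀]
      calc ENNReal.ofReal (x ^ 2) ≤ ENNReal.ofReal (4 * δ₀ ^ 2 + 2 * ε)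
            + ENNReal.ofReal (4 * W j y) := by
            rw [← ENNReal.ofReal_add (by positivity) (by have := hW0 j y; positivity)]
            exact ENNReal.ofReal_le_ofReal h2
        _ ≤ _ := add_le_add le_rfl (ENNReal.le_tsum j)
  have hgeo : HasSum (fun j : ℕ => 4 * (e / 2 ^ j)) (8 * e) := by
    have h := hasSum_geometric_two.mul_left (4 * e)
    have e1 : (fun j : ℕ => 4 * (e / 2 ^ j)) = fun j : ℕ => 4 * e * (1 / 2) ^ j := by
      funext j
      rw [one_div, inv_pow]
      ring
    have e2 : 8 * e = 4 * e * 2 := by ring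
    rw [e1, e2]
    exact h
  calc ∫⁻ y, D y ^ 2 ∂P ≤ ∫⁻ y, (ENNReal.ofReal (4 * δ₀ ^ 2 + 2 * ε)
        + ∑' j, ENNReal.ofReal (4 * W j y)) ∂P := lintegral_mono hpt
    _ = ENNReal.ofReal (4 * δ₀ ^ 2 + 2 * ε) + ∑' j, ∫⁻ y, ENNReal.ofReal (4 * W j y) ∂P := by
        rw [lintegral_add_left measurable_const, lintegral_const, measure_univ, mul_one,
          lintegral_tsum fun j => ((hWm j).const_mul 4).ennreal_ofReal]
    _ ≤ ENNReal.ofReal (4 * δ₀ ^ 2 + 2 * ε) + ∑' j : ℕ, ENNReal.ofReal (4 * (e / 2 ^ j)) := by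
        refine add_le_add le_rfl (ENNReal.tsum_le_tsum fun j => ?_)
        simp_rw [ENNReal.ofReal_mul (show (0 : ℝ) ≤ 4 by norm_num)]
        rw [lintegral_const_mul' _ _ ENNReal.ofReal_ne_top]
        gcongr
        exact hWi j
    _ = _ := by
        rw [← ENNReal.ofReal_tsum_of_nonneg (fun j => by positivity) hgeo.summable,
          hgeo.tsum_eq, ← ENNReal.ofReal_add (by positivity) (by positivity)]
        congr 1
        ring

theorem theorem4 {d : ℕ} {Y : Type*} [MeasurableSpace Y] (ν : Measure Y)
    -- the operator, the adjoint of its inverse, and the function class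
    (A Q : L2Operator (volume : Measure (EuclideanSpace ℝ (Fin d))) ν)
    (hAQ : IsAdjointOfInverse A Q)
    (F : Set (EuclideanSpace ℝ (Fin d) → ℝ))
    (hFA : ∀ f ∈ F, f ∈ A.domain) (hFQ : ∀ f ∈ F, f ∈ Q.domain)
    (B₂ : ℝ) (hB₂ : 0 < B₂) (hF : ∀ f ∈ F, eLpNorm f 2 volume ≤ ENNReal.ofReal B₂)
    -- the bracketing nets
    (net : ℝ → Finset ((EuclideanSpace ℝ (Fin d) → ℝ) × (EuclideanSpace ℝ (Fin d) → ℝ)))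
    (hnet : ∀ δ, 0 < δ → IsBracketingNet volume F δ (net δ))
    (hnetQ : ∀ δ, 0 < δ → ∀ p ∈ net δ, p.1 ∈ Q.domain ∧ p.2 ∈ Q.domain)
    -- assumptions on the entropy integral and the operator norm
    (a c : ℝ) (ha : 0 ≤ a) (ha1 : a < 1) (hc : 0 < c)
    (h1 : IntegrableOn (entropyIntegrand Q net) (Ioc 0 B₂))
    (h2 : AntitoneOn (fun δ => entropyIntegral Q net δ / δ ^ 2) (Ioc 0 B₂))
    (h3 : ∀ δ ∈ Ioc 0 B₂, rhoDen Q net δ = c * δ ^ (-a))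
    (h4 : Tendsto (fun δ => entropyIntegral Q net δ * δ ^ (a - 1)) (𝓝[>] 0) atTop)
    (h5 : AntitoneOn (entropyIntegrand Q net) (Ioc 0 B₂))
    -- boundedness and positivity
    (hAbdd : (⨆ f ∈ F, eLpNorm (A f) ⊤ ν) < ⊤)
    (hQbdd : (⨆ g ∈ lowerFns (net B₂) ∪ upperFns (net B₂), eLpNorm (Q g) ⊤ ν) < ⊤)
    (hQpos : PreservesPositivity Q)
    (C : ℝ) (hC : 0 < C) :
    ∃ C' : ℝ, 0 < C' ∧ ∀ ψ : ℕ → ℝ,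
      (∀ᶠ n : ℕ in atTop, ψ n ∈ Ioc 0 B₂ ∧
        C * (n : ℝ) ^ (-(1 / 2) : ℝ) * entropyIntegral Q net (ψ n) ≤ ψ n ^ 2) →
      Tendsto (fun n : ℕ => (n : ℝ) * ψ n ^ (2 * (1 + a))) atTop atTop →
      ∀ᶠ n : ℕ in atTop, ∀ ε : ℝ, 0 < ε → ∀ f ∈ F, IsProbDensity ν (A f) →
        ∀ fhat : (Fin n → Y) → (EuclideanSpace ℝ (Fin d) → ℝ), IsDenseMinimizer Q F ε fhat →
          AEMeasurable (fun y => eLpNorm (fhat y - f) 2 volume) (sampleLaw ν (A f) n) →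
          ∫⁻ y, eLpNorm (fhat y - f) 2 volume ^ 2 ∂(sampleLaw ν (A f) n)
            ≤ ENNReal.ofReal (C' * (ψ n ^ 2 + ε)) := by
  obtain ⟨M, hM, hMA⟩ : ∃ M : ℝ, 0 < M ∧ ∀ f ∈ F, ∀ᵐ y ∂ν, A f y ≤ M := by
    refine ⟨(⨆ f ∈ F, eLpNorm (A f) ⊤ ν).toReal + 1, by positivity, fun f hf => ?_⟩
    filter_upwards [ae_abs_le_of_eLpNorm_top_le hAbdd.ne
      (le_iSup₂ (f := fun f (_ : f ∈ F) => eLpNorm (A f) ⊤ ν) f hf)] with y hy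
    linarith [le_abs_self (A f y)]
  obtain ⟨η, hη, E₁, hE₁, hshell⟩ := exists_shell_bound (A := A) (Q := Q) hFQ hB₂ hnet hnetQ ha ha1
    hc h1 h3 h5 hM hMA (b := (⨆ g ∈ lowerFns (net B₂) ∪ upperFns (net B₂),
      eLpNorm (Q g) ⊤ ν).toReal) ENNReal.toReal_nonneg
    (fun p hp => ⟨ae_abs_le_of_eLpNorm_top_le hQbdd.ne
      (le_iSup₂ (f := fun g (_ : g ∈ lowerFns (net B₂) ∪ upperFns (net B₂)) => eLpNorm (Q g) ⊤ ν)
        p.1 (Or.inl ⟨p, hp, rfl⟩)),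
      ae_abs_le_of_eLpNorm_top_le hQbdd.ne
      (le_iSup₂ (f := fun g (_ : g ∈ lowerFns (net B₂) ∪ upperFns (net B₂)) => eLpNorm (Q g) ⊤ ν)
        p.2 (Or.inr ⟨p, hp, rfl⟩))⟩) hQpos
  -- the factor by which the radius `ψ n` is enlarged, so that the entropy integral becomes small
  -- relative to the squared radius, whatever the constant `C`
  set L : ℝ := max 1 (2 * √M / (η * C)) with hL_def
  have hL1 : 1 ≤ L := le_max_left _ _
  have hL0 : 0 < L := by linarith
  have hLC : 2 * √M ≤ L * (η * C) := by
    rw [← div_le_iff₀ (by positivity)]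
    exact le_max_right _ _
  refine ⟨4 * L ^ 2 + 8 * (E₁ * L ^ 2) + 2, by positivity, fun ψ hψ hlim => ?_⟩
  filter_upwards [hψ, hlim.eventually_ge_atTop 1, eventually_ne_atTop 0]
    with n hψn hlarge hn ε hε f hf hd fhat hmin _
  obtain ⟨hψmem, hψG⟩ := hψn
  have hψ0 : 0 < ψ n := hψmem.1
  have hn0 : (0 : ℝ) < n := by exact_mod_cast Nat.pos_of_ne_zero hn
  have hNpos : 0 < √(n : ℝ) := Real.sqrt_pos.2 hn0
  have hGψ : C * entropyIntegral Q net (ψ n) ≤ √n * ψ n ^ 2 := by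
    rw [Real.rpow_neg hn0.le, ← Real.sqrt_eq_rpow] at hψG
    have := mul_le_mul_of_nonneg_left hψG hNpos.le
    calc _ = √n * (C * (√n)⁻¹ * entropyIntegral Q net (ψ n)) := by field_simp
      _ ≤ _ := this
  -- concavity of the entropy integral
  have hG : ∀ δ, L * ψ n ≤ δ → δ ≤ B₂ →
      2 * √M * entropyIntegral Q net δ ≤ η * √n * δ ^ 2 := fun δ hδ hδB => by
    have hψδ : ψ n ≤ δ := (le_mul_of_one_le_left hψ0.le hL1).trans hδ
    have hδ0 : 0 < δ := hψ0.trans_le hψδ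
    have hcc : entropyIntegral Q net δ ≤ δ / ψ n * entropyIntegral Q net (ψ n) :=
      setIntegral_le_div_mul h1 h5 hψ0 hψδ hδB
    calc 2 * √M * entropyIntegral Q net δ
        ≤ 2 * √M * (δ / ψ n * (√n * ψ n ^ 2 / C)) := by
          gcongr
          refine hcc.trans ?_
          gcongr
          rw [le_div_iff₀ hC]
          linarith
      _ = 2 * √M * (δ * √n * ψ n / C) := by field_simp
      _ ≤ L * (η * C) * (δ * √n * ψ n / C) := by gcongr
      _ = η * √n * δ * (L * ψ n) := by field_simp
      _ ≤ η * √n * δ * δ := by gcongr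
      _ = _ := by ring
  have : IsProbabilityMeasure (densityLaw ν (A f)) := hd.isProbabilityMeasure
  have hprob : IsProbabilityMeasure (sampleLaw ν (A f) n) := by
    unfold sampleLaw
    infer_instance
  have hf2 := Q.memLp_of_mem f (hFQ f hf)
  have hfhat2 : ∀ y, MemLp (fhat y) 2 volume := fun y => Q.memLp_of_mem _ (hFQ _ (hmin y).1)
  have hR : 1 ≤ √(n : ℝ) * (L * ψ n) ^ (1 + a) := by
    have h7 : (n : ℝ) * ψ n ^ (2 * (1 + a)) = (√n * ψ n ^ (1 + a)) ^ 2 := by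
      rw [mul_pow, Real.sq_sqrt hn0.le, ← Real.rpow_natCast (ψ n ^ (1 + a)),
        ← Real.rpow_mul hψ0.le]
      congr 2
      push_cast
      ring
    have h8 : 1 ≤ √n * ψ n ^ (1 + a) := by
      rw [h7] at hlarge
      exact (one_le_sq_iff₀ (by positivity)).1 hlarge
    refine h8.trans (mul_le_mul_of_nonneg_left ?_ hNpos.le)
    exact Real.rpow_le_rpow hψ0.le (le_mul_of_one_le_left hψ0.le hL1) (by linarith)
  have hLψ : 0 < L * ψ n := by positivity
  have key := lintegral_sq_le_of_shells (P := sampleLaw ν (A f) n)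
    (D := fun y => eLpNorm (fhat y - f) 2 volume) (B := B₂) (δ₀ := L * ψ n)
    (e := E₁ * (L * ψ n) ^ 2) (ε := ε) hLψ (by positivity) hε
    (fun y => by
      refine (eLpNorm_sub_le (hfhat2 y).1 hf2.1 one_le_two).trans ?_
      refine (add_le_add (hF _ (hmin y).1) (hF f hf)).trans_eq ?_
      rw [← ENNReal.ofReal_add hB₂.le hB₂.le, two_mul])
    (fun j hj => by
      have hj1 : (1 : ℝ) ≤ 2 ^ j := one_le_pow₀ (by norm_num)
      have hjge : L * ψ n ≤ 2 ^ j * (L * ψ n) := le_mul_of_one_le_left hLψ.le hj1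
      have hjpos : 0 < 2 ^ j * (L * ψ n) := by positivity
      obtain ⟨W, w1, w2, w3, w4⟩ := hshell n hn (2 ^ j * (L * ψ n)) ⟨hjpos, hj⟩
        (hG _ hjge hj) f hf hd
      refine ⟨W, w1, w2, w3.trans (ENNReal.ofReal_le_ofReal ?_), fun y hy => ?_⟩
      · have h9 : (2 : ℝ) ^ j ≤ √n * (2 ^ j * (L * ψ n)) ^ (1 + a) := by
          rw [Real.mul_rpow (by positivity) hLψ.le]
          have h10 : (2 : ℝ) ^ j ≤ (2 ^ j) ^ (1 + a) :=
            Real.self_le_rpow_of_one_le hj1 (by linarith)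
          calc (2 : ℝ) ^ j ≤ (2 ^ j) ^ (1 + a) * 1 := by rw [mul_one]; exact h10
            _ ≤ (2 ^ j) ^ (1 + a) * (√n * (L * ψ n) ^ (1 + a)) := by gcongr
            _ = _ := by ring
        calc E₁ * (2 ^ j * (L * ψ n)) ^ 2 / (√n * (2 ^ j * (L * ψ n)) ^ (1 + a)) ^ 4
            ≤ E₁ * (2 ^ j * (L * ψ n)) ^ 2 / (2 ^ j) ^ 4 := by gcongr
          _ = E₁ * (L * ψ n) ^ 2 / (2 ^ j) ^ 2 := by field_simp
          _ ≤ _ := by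
            gcongr
            exact le_self_pow₀ hj1 two_ne_zero
      · have h11 := sq_eLpNorm_sub_le hAQ (hFA f hf) (hFQ f hf) (hFQ _ (hmin y).1) hd
          ((hmin y).2 f hf)
        have h12 := w4 y (fhat y) (hmin y).1
          ((ENNReal.le_ofReal_iff_toReal_le ((hfhat2 y).sub hf2).eLpNorm_ne_top
            (by positivity)).2 hy)
        linarith)
  refine key.trans (ENNReal.ofReal_le_ofReal ?_)
  have : 0 ≤ (4 * L ^ 2 + 8 * (E₁ * L ^ 2)) * ε := by positivity
  nlinarith [sq_nonneg (ψ n)]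

end Main
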